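/- Let $2\le k<n$ and let $V$ be a distribution of $k$-planes of class $C^1$ on $\mathbb{R}^n$, that is, a map assigning to every $x\in\mathbb{R}^n$ a $k$-dimensional linear subspace $V(x)\subseteq\mathbb{R}^n$ which is locally spanned by $k$ vector fields of class $C^1$. Then for every real number $d$ with $0\le d<k$ there exists a nonempty embedded $k$-dimensional submanifold $S\subset\mathbb{R}^n$ (without boundary, not necessarily closed) of class $C^{1,1}$ such that the tangency set $$\tau(S,V):=\{x\in S:\ \mathrm{Tan}(S,x)=V(x)\}$$ has Hausdorff dimension exactly $d$, i.e. $\dim_{\mathscr H}\bigl(\tau(S,V)\bigr)=d$. Here $\mathrm{Tan}(S,x)$ is the tangent space of $S$ at $x$, and $S$ is of class $C^{1,1}$ if each of its points has an open neighbourhood $U$ such that $S\cap U$ is the graph of a function $f:\Omega\to W^\perp$, where $W\subseteq\mathbb{R}^n$ is a $k$-dimensional linear subspace, $\Omega\subseteq W$ is open, $f$ is continuously differentiable and its differential $Df$ is Lipschitz on $\Omega$. (The empty set has Hausdorff dimension $0$.) -/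

import Mathlib

open scoped NNReal ENNReal Topology

section Frobenius

variable {E : Type*} [NormedAddCommGroup E] [InnerProductSpace ℝ E]

/-- `V` is a distribution of `k`-planes of class `C^1` on the space `E`: it assigns to every
point a `k`-dimensional linear subspace, and every point has an open neighbourhood on which
these subspaces are spanned by `k` vector fields of class `C^1`. -/
def IsC1Distribution (k : ℕ) (V : E → Submodule ℝ E) : Prop :=
  (∀ x, Module.finrank ℝ (V x) = k) ∧
    ∀ x : E, ∃ U : Set E, IsOpen U ∧ x ∈ U ∧ ∃ X : Fin k → E → E,
      (∀ i, ContDiffOn ℝ 1 (X i) U) ∧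
        ∀ y ∈ U, V y = Submodule.span ℝ (Set.range fun i => X i y)

/-- The graph over `Ω ⊆ W` of a map from a subspace `W` to its orthogonal complement, as a
subset of the ambient space. -/
def graphOver (W : Submodule ℝ E) (Ω : Set W) (f : W → Wᗮ) : Set E :=
  {x | ∃ w ∈ Ω, x = (w : E) + (f w : E)}

/-- `f` is of class `C^{1,1}` on the open set `Ω`: it is continuously differentiable on `Ω`
and its differential is Lipschitz on `Ω`. -/
def IsC11On {F G : Type*} [NormedAddCommGroup F] [NormedSpace ℝ F]
    [NormedAddCommGroup G] [NormedSpace ℝ G] (f : F → G) (Ω : Set F) : Prop :=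
  ContDiffOn ℝ 1 f Ω ∧ ∃ L : ℝ≥0, LipschitzOnWith L (fderiv ℝ f) Ω

/-- `S` is an (embedded) `k`-dimensional submanifold of class `C^{1,1}`: near each of its
points it is the graph, over an open subset of a `k`-dimensional subspace `W`, of a map of
class `C^{1,1}` with values in the orthogonal complement of `W`. -/
def IsC11Submanifold (k : ℕ) (S : Set E) : Prop :=
  ∀ p ∈ S, ∃ U : Set E, IsOpen U ∧ p ∈ U ∧
    ∃ W : Submodule ℝ E, Module.finrank ℝ W = k ∧
      ∃ (Ω : Set W) (f : W → Wᗮ), IsOpen Ω ∧ IsC11On f Ω ∧ S ∩ U = graphOver W Ω f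

/-- The classical tangent space of `S` at `p`: all velocities at time `0` of curves that pass
through `p` at time `0` and stay in `S` for small times of either sign. -/
def tangentVectors (S : Set E) (p : E) : Set E :=
  {v | ∃ γ : ℝ → E, γ 0 = p ∧ (∀ᶠ t in 𝓝 (0 : ℝ), γ t ∈ S) ∧ HasDerivAt γ v 0}

/-- The tangency set of `S` with respect to `V`: the points of `S` at which the tangent space
of `S` equals the plane of `V`. -/
def tangencySet (S : Set E) (V : E → Submodule ℝ E) : Set E :=
  {p | p ∈ S ∧ tangentVectors S p = (V p : Set E)}

end Frobenius

/-!
Near the origin the planes `V x` are the graphs of linear maps `A x : W → Wᗮ`, where `W = V 0` and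
`A` is of class `C^1`, hence Lipschitz (`exists_chart`). The graph of `f : W → Wᗮ` is tangent to `V`
over `w` exactly if `Df(w) = A(w + f(w))` (`tangentVectors_graphOver`). So it suffices to find `f` of
class `C^{1,1}` for which this equation holds exactly on a set of dimension `d`. After a choice of
coordinates and a rescaling, which makes the Lipschitz constant of `A` as small as desired
(`exists_scale`), the domain is the unit cube of `ℝ^k`.

The set is the self-similar Cantor dust `K` with `2 ^ k` children per cube and ratio `lam < 1/2`. Its
dimension is `k * log 2 / log (1 / lam)`: the upper bound comes from counting cubes
(`dimH_cantorDust_le`), the lower one from the Hölder map of `K` onto the full cube that reads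
addresses with the ratio `1/2` (`le_dimH_cantorDust`). Hence all dimensions in `(0, k)` occur.

The function `f` is built along the tree of cubes. On a cube with centre `c`, half-side `r` and
central value `v`, it is modelled by the affine map with value `v` at `c` and slope
`A(c, v) + r • E`, where `E` is a fixed map of rank one; the value at the centre of a child is read
off from the affine map of the parent. Passing to a child is done by adding the difference of the
two affine maps, cut off to the orthant of the child. This difference has slope of order `r` because
`A` is Lipschitz, and it is cut off at the scale `lam * r`, so its second differential is bounded
uniformly. Near each point at most one of these corrections is not affine, so second differentials
do not accumulate and the limit is of class `C^{1,1}` (`norm_fderiv_fderiv_approx_le`,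
`exists_contDiff_limit`).

On `K` the slopes converge to `A`, so that `Df = A` there (`fderiv_eq_of_forall_mem`). Off `K`, at a
point whose last cube has half-side `r`, the tilt `r • E` contributes at least `lam * r` to one
entry of `Df - A`: the cut-off is nonincreasing in the absolute value of each relative coordinate, so
the transition from the tilt `r • E` to the tilt `lam * r • E` of the child never takes this
contribution below `lam * r`. All other contributions are at most a small multiple of `r`, hence `Df ≠ A` (`fderiv_ne_of_exit`). For `d = 0`
the closed set `K` is removed from the domain of `f`, which leaves no point of tangency.
-/

/-! ### A cut-off identity map -/

/-- A cut-off `ψ` on the line; the sign of `t * ψ' t` says that `ψ` is nonincreasing in `|t|`. -/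
lemma exists_cutoff_mul_deriv_nonpos {a b : ℝ} (ha : 0 < a) (hab : a < b) :
    ∃ ψ : ℝ → ℝ, ContDiff ℝ 2 ψ ∧ (∀ t, 0 ≤ ψ t) ∧ (∀ t, ψ t ≤ 1) ∧ (∀ t, |t| ≤ a → ψ t = 1) ∧
      (∀ t, b ≤ |t| → ψ t = 0) ∧ ∀ t, t * deriv ψ t ≤ 0 := by
  have hc : 0 < b ^ 2 - a ^ 2 := by nlinarith
  set q : ℝ → ℝ := fun t => (b ^ 2 - t ^ 2) / (b ^ 2 - a ^ 2) with hq
  have hqd : ∀ t, HasDerivAt q (-(2 * t) / (b ^ 2 - a ^ 2)) t := by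
    intro t
    have h := ((hasDerivAt_pow 2 t).const_sub (b ^ 2)).div_const (b ^ 2 - a ^ 2)
    simpa using h
  refine ⟨fun t => Real.smoothTransition (q t), ?_, fun t => Real.smoothTransition.nonneg _,
    fun t => Real.smoothTransition.le_one _, ?_, ?_, ?_⟩
  · refine Real.smoothTransition.contDiff.comp ?_
    fun_prop
  · intro t ht
    apply Real.smoothTransition.one_of_one_le
    rw [hq, le_div_iff₀ hc]
    have : t ^ 2 ≤ a ^ 2 := sq_le_sq.2 (by rwa [abs_of_pos ha])
    linarith
  · intro t ht
    apply Real.smoothTransition.zero_of_nonpos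
    rw [hq]
    apply div_nonpos_of_nonpos_of_nonneg _ hc.le
    have : b ^ 2 ≤ t ^ 2 := sq_le_sq.2 (by rwa [abs_of_pos (ha.trans hab)])
    linarith
  · intro t
    have hd : DifferentiableAt ℝ Real.smoothTransition (q t) :=
      (Real.smoothTransition.contDiff (n := 1)).differentiable (by simp) _
    have h := hd.hasDerivAt.comp t (hqd t)
    have h' : deriv (fun t => Real.smoothTransition (q t)) t =
        deriv Real.smoothTransition (q t) * (-(2 * t) / (b ^ 2 - a ^ 2)) := h.deriv
    rw [h']
    have h0 : 0 ≤ deriv Real.smoothTransition (q t) := Real.smoothTransition.monotone.deriv_nonneg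
    have : t * (deriv Real.smoothTransition (q t) * (-(2 * t) / (b ^ 2 - a ^ 2))) =
      -(deriv Real.smoothTransition (q t) * (2 * t ^ 2 / (b ^ 2 - a ^ 2))) := by ring
    rw [this]
    have : 0 ≤ 2 * t ^ 2 / (b ^ 2 - a ^ 2) := by positivity
    nlinarith [mul_nonneg h0 this]

/-- The `i₀`-th component of `y ↦ (∏ i, ψ (y i)) • y` has slope at most `1` along the `i₀`-th axis,
because there it is `t ↦ Q * (ψ t * t)` with a constant `Q ∈ [0, 1]`. -/
lemma fderiv_prod_smul_apply_le {k : ℕ} (i₀ : Fin k) {ψ : ℝ → ℝ} (hψ : ContDiff ℝ 2 ψ)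
    (hψ0 : ∀ t, 0 ≤ ψ t) (hψ1 : ∀ t, ψ t ≤ 1) (hψd : ∀ t, t * deriv ψ t ≤ 0) (y : Fin k → ℝ) :
    fderiv ℝ (fun y : Fin k → ℝ => (∏ i, ψ (y i)) • y) y (Pi.single i₀ 1) i₀ ≤ 1 := by
  set Q : ℝ := ∏ i ∈ Finset.univ.erase i₀, ψ (y i) with hQ
  have hQ0 : 0 ≤ Q := Finset.prod_nonneg fun i _ => hψ0 _
  have hQ1 : Q ≤ 1 := Finset.prod_le_one (fun i _ => hψ0 _) fun i _ => hψ1 _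
  have hψi : ∀ i, HasFDerivAt (fun y : Fin k → ℝ => ψ (y i))
      (deriv ψ (y i) • (ContinuousLinearMap.proj i : (Fin k → ℝ) →L[ℝ] ℝ)) y := fun i =>
    (hψ.differentiable (by simp) (y i)).hasDerivAt.comp_hasFDerivAt y
      (ContinuousLinearMap.proj (R := ℝ) (φ := fun _ : Fin k => ℝ) i).hasFDerivAt
  have hp := (HasFDerivAt.finsetProd (u := Finset.univ) fun i _ => hψi i).smul (hasFDerivAt_id y)
  have hp' : fderiv ℝ (fun y : Fin k → ℝ => (∏ i, ψ (y i)) • y) y = _ := hp.fderiv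
  rw [hp']
  have h1 : (∏ i, ψ (y i)) = ψ (y i₀) * Q := (Finset.mul_prod_erase _ _ (Finset.mem_univ i₀)).symm
  have h2 : (∑ i, (∏ j ∈ Finset.univ.erase i, ψ (y j)) * (deriv ψ (y i) *
      (Pi.single i₀ (1 : ℝ) : Fin k → ℝ) i)) = Q * deriv ψ (y i₀) := by
    rw [Finset.sum_eq_single i₀]
    · simp [hQ]
    · intro b _ hb; simp [hb]
    · simp
  have h3 : deriv ψ (y i₀) * y i₀ + ψ (y i₀) ≤ 1 := by linarith [hψ1 (y i₀), hψd (y i₀)]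
  simp only [add_apply, smul_apply, id,
    ContinuousLinearMap.smulRight_apply, sum_apply, Pi.add_apply, Pi.smul_apply,
    smul_eq_mul, ContinuousLinearMap.proj_apply, ContinuousLinearMap.id_apply, Pi.single_eq_same,
    h1, h2]
  nlinarith

/-- `Φ` is a cut-off of the identity map of `ℝ^k` at the radius `ρ`, with first and second
differentials bounded by `M`, whose `i₀`-th component has slope at most `1` in the direction of the
`i₀`-th coordinate. -/
structure IsCutoffId {k : ℕ} (i₀ : Fin k) (ρ M : ℝ) (Φ : (Fin k → ℝ) → (Fin k → ℝ)) : Prop where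
  contDiff : ContDiff ℝ 2 Φ
  eventuallyEq_id : ∀ y, ‖y‖ ≤ 1 → Φ =ᶠ[𝓝 y] id
  eventuallyEq_zero : ∀ y, ρ ≤ ‖y‖ → Φ =ᶠ[𝓝 y] 0
  norm_le : ∀ y, ‖Φ y‖ ≤ ρ
  norm_fderiv_le : ∀ y, ‖fderiv ℝ Φ y‖ ≤ M
  norm_fderiv_fderiv_le : ∀ y, ‖fderiv ℝ (fderiv ℝ Φ) y‖ ≤ M
  fderiv_apply_le : ∀ y, fderiv ℝ Φ y (Pi.single i₀ 1) i₀ ≤ 1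

lemma exists_norm_fderiv_le_of_hasCompactSupport {E F : Type*} [NormedAddCommGroup E]
    [NormedSpace ℝ E] [NormedAddCommGroup F] [NormedSpace ℝ F] {Φ : E → F} (hΦ : ContDiff ℝ 1 Φ)
    (hc : HasCompactSupport Φ) : ∃ M, ∀ y, ‖fderiv ℝ Φ y‖ ≤ M :=
  (hΦ.continuous_fderiv (by simp)).bounded_above_of_compact_support (hc.fderiv ℝ)

lemma exists_bound_fderiv_of_hasCompactSupport {E F : Type*} [NormedAddCommGroup E]
    [NormedSpace ℝ E] [NormedAddCommGroup F] [NormedSpace ℝ F] {Φ : E → F} (hΦ : ContDiff ℝ 2 Φ)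
    (hc : HasCompactSupport Φ) :
    ∃ M, 0 ≤ M ∧ (∀ y, ‖fderiv ℝ Φ y‖ ≤ M) ∧ ∀ y, ‖fderiv ℝ (fderiv ℝ Φ) y‖ ≤ M := by
  have hd1 : ContDiff ℝ 1 (fderiv ℝ Φ) := hΦ.fderiv_right (by norm_num)
  obtain ⟨M₁, hM₁⟩ := exists_norm_fderiv_le_of_hasCompactSupport (hΦ.of_le (by norm_num)) hc
  obtain ⟨M₂, hM₂⟩ := exists_norm_fderiv_le_of_hasCompactSupport hd1 (hc.fderiv ℝ)
  exact ⟨max M₁ M₂, le_max_of_le_left ((norm_nonneg _).trans (hM₁ 0)),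
    fun y => (hM₁ y).trans (le_max_left _ _), fun y => (hM₂ y).trans (le_max_right _ _)⟩

lemma exists_isCutoffId {k : ℕ} (i₀ : Fin k) {ρ : ℝ} (hρ : 1 < ρ) :
    ∃ M Φ, 0 ≤ M ∧ IsCutoffId i₀ ρ M Φ := by
  obtain ⟨ψ, hψ, hψ0, hψ1, hψa, hψb, hψd⟩ := exists_cutoff_mul_deriv_nonpos
    (a := 1 + (ρ - 1) / 3) (b := 1 + 2 * (ρ - 1) / 3) (by linarith) (by linarith)
  set φ : (Fin k → ℝ) → ℝ := fun y => ∏ i, ψ (y i) with hφ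
  set Φ : (Fin k → ℝ) → (Fin k → ℝ) := fun y => φ y • y with hΦ
  have hφ0 : ∀ y, 0 ≤ φ y := fun y => Finset.prod_nonneg fun i _ => hψ0 _
  have hφ1 : ∀ y, φ y ≤ 1 := fun y => Finset.prod_le_one (fun i _ => hψ0 _) fun i _ => hψ1 _
  have hφs : ContDiff ℝ 2 φ := contDiff_prod fun i _ => hψ.comp (contDiff_apply ℝ ℝ i)
  have hΦs : ContDiff ℝ 2 Φ := hφs.smul contDiff_id
  have hφb : ∀ y, 1 + 2 * (ρ - 1) / 3 ≤ ‖y‖ → φ y = 0 := by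
    intro y hy
    have : ¬ ∀ i, ‖y i‖ < 1 + 2 * (ρ - 1) / 3 := by
      rw [← pi_norm_lt_iff (by linarith)]; exact not_lt.2 hy
    push Not at this
    obtain ⟨i, hi⟩ := this
    exact Finset.prod_eq_zero (Finset.mem_univ i) (hψb _ hi)
  have hφa : ∀ y, ‖y‖ ≤ 1 + (ρ - 1) / 3 → φ y = 1 := by
    intro y hy
    exact Finset.prod_eq_one fun i _ => hψa _ ((norm_le_pi_norm y i).trans hy)
  have hz : ∀ y, ρ ≤ ‖y‖ → Φ =ᶠ[𝓝 y] 0 := by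
    intro y hy
    have : {z : Fin k → ℝ | 1 + 2 * (ρ - 1) / 3 < ‖z‖} ∈ 𝓝 y :=
      (isOpen_lt continuous_const continuous_norm).mem_nhds
        (by simp only [Set.mem_ofPred_eq]; linarith)
    filter_upwards [this] with z hz
    simp [hΦ, hφb z (le_of_lt hz)]
  have hcs : HasCompactSupport Φ := by
    refine HasCompactSupport.intro (isCompact_closedBall (0 : Fin k → ℝ) ρ) ?_
    intro y hy
    exact (hz y (by simp at hy; exact hy.le)).self_of_nhds
  obtain ⟨M, hM, hM₁, hM₂⟩ := exists_bound_fderiv_of_hasCompactSupport hΦs hcs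
  refine ⟨M, Φ, hM, hΦs, ?_, hz, ?_, hM₁, hM₂, ?_⟩
  · intro y hy
    have : {z : Fin k → ℝ | ‖z‖ < 1 + (ρ - 1) / 3} ∈ 𝓝 y :=
      (isOpen_lt continuous_norm continuous_const).mem_nhds
        (by simp only [Set.mem_ofPred_eq]; linarith)
    filter_upwards [this] with z hz
    simp [hΦ, hφa z (le_of_lt hz)]
  · intro y
    by_cases hy : ρ ≤ ‖y‖
    · rw [(hz y hy).self_of_nhds]; simp; linarith
    · rw [hΦ]
      simp only [norm_smul, Real.norm_eq_abs, abs_of_nonneg (hφ0 y)]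
      push Not at hy
      calc φ y * ‖y‖ ≤ 1 * ‖y‖ := by gcongr; exact hφ1 y
        _ ≤ ρ := by linarith
  · exact fderiv_prod_smul_apply_le i₀ hψ hψ0 hψ1 hψd

/-! ### The Cantor dust -/

/-- The position of a child cube relative to its parent of half-side `1`: the point with
coordinates `±1/2` and the given signs (`true` for `+`). -/
noncomputable def cubeCorner {k : ℕ} (σ : Fin k → Bool) : Fin k → ℝ :=
  fun i => if σ i then 1 / 2 else -(1 / 2)

/-- The orthant that contains the point `z`; points on the coordinate hyperplanes are assigned to
the orthant with the larger coordinate. -/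
noncomputable def signPattern {k : ℕ} (z : Fin k → ℝ) : Fin k → Bool := fun i => decide (0 ≤ z i)

/-- The centres of the cubes selected by the point `x`: in each cube of the `j`-th generation, of
half-side `lam ^ j`, choose the child in the orthant of `x`. This makes sense even if `x` is outside
the selected cubes. -/
noncomputable def cubeCenter {k : ℕ} (lam : ℝ) (x : Fin k → ℝ) : ℕ → Fin k → ℝ
  | 0 => 0
  | j + 1 => cubeCenter lam x j + lam ^ j • cubeCorner (signPattern (x - cubeCenter lam x j))

/-- The self-similar Cantor dust in `ℝ^k` with `2 ^ k` children per cube and ratio `lam`. -/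
def cantorDust (k : ℕ) (lam : ℝ) : Set (Fin k → ℝ) := {x | ∀ j, ‖x - cubeCenter lam x j‖ ≤ lam ^ j}

lemma norm_cubeCorner_le {k : ℕ} (σ : Fin k → Bool) : ‖cubeCorner σ‖ ≤ 1 / 2 := by
  rw [pi_norm_le_iff_of_nonneg (by norm_num)]
  intro i
  unfold cubeCorner
  split_ifs <;> norm_num

lemma norm_smul_cubeCorner_le {k : ℕ} {r : ℝ} (hr : 0 < r) (σ : Fin k → Bool) :
    ‖r • cubeCorner σ‖ ≤ r / 2 := by
  rw [norm_smul, Real.norm_eq_abs, abs_of_pos hr]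
  nlinarith [norm_cubeCorner_le σ]

/-- Only the child in the orthant of `z` is closer to `z` than `r / 2`. -/
lemma half_le_norm_sub_cubeCorner {k : ℕ} {z : Fin k → ℝ} {σ : Fin k → Bool}
    (h : σ ≠ signPattern z) (r : ℝ) : r / 2 ≤ ‖z - r • cubeCorner σ‖ := by
  obtain ⟨i, hi⟩ := Function.ne_iff.1 h
  refine le_trans ?_ (norm_le_pi_norm _ i)
  simp only [Pi.sub_apply, Pi.smul_apply, smul_eq_mul, Real.norm_eq_abs]
  by_cases hz : 0 ≤ z i
  · have : σ i = false := by simpa [signPattern, hz] using hi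
    simp only [cubeCorner, this]
    refine le_trans ?_ (le_abs_self _)
    simp; linarith
  · have : σ i = true := by simpa [signPattern, hz] using hi
    simp only [cubeCorner, this]
    refine le_trans ?_ (neg_le_abs _)
    simp; linarith

/-! ### Cells and their affine approximations -/

/-- The data of the construction: the field `A` of prescribed differentials, with small Lipschitz
constant `ε`, the ratio `lam` of the dust, a cut-off `Φ` of the identity, and a linear map `E` which
`η` reduces to the `i₀`-th coordinate and which is used to break tangency off the dust. -/
structure SlopeData (k : ℕ) (G : Type*) [NormedAddCommGroup G] [NormedSpace ℝ G] where
  i₀ : Fin k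
  A : (Fin k → ℝ) × G → (Fin k → ℝ) →L[ℝ] G
  E : (Fin k → ℝ) →L[ℝ] G
  η : G →L[ℝ] ℝ
  lam : ℝ
  M : ℝ
  ε : ℝ
  Φ : (Fin k → ℝ) → (Fin k → ℝ)
  lam_pos : 0 < lam
  lam_lt : lam < 1 / 2
  M_nonneg : 0 ≤ M
  ε_nonneg : 0 ≤ ε
  ε_small : (3 + M) * ε < lam
  cutoff : IsCutoffId i₀ (1 / (2 * lam)) M Φ
  norm_A_sub_le : ∀ p q, ‖p‖ ≤ 3 → ‖q‖ ≤ 3 → ‖A p - A q‖ ≤ ε * ‖p - q‖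
  A_zero : A 0 = 0
  norm_E_le : ‖E‖ ≤ 1
  norm_η_le : ‖η‖ ≤ 1
  η_E : ∀ x, η (E x) = x i₀

/-- A cube of the construction, with centre `c` and half-side `r`, together with the value `v`
prescribed at its centre. -/
structure Cell (k : ℕ) (G : Type*) where
  c : Fin k → ℝ
  v : G
  r : ℝ

namespace SlopeData

variable {k : ℕ} {G : Type*} [NormedAddCommGroup G] [NormedSpace ℝ G] (D : SlopeData k G)

/-- The differential used on a cell: the prescribed one at the centre, tilted by `r • E`. -/
noncomputable def slope (s : Cell k G) : (Fin k → ℝ) →L[ℝ] G := D.A (s.c, s.v) + s.r • D.E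

/-- The affine map used on a cell. -/
noncomputable def affine (s : Cell k G) (x : Fin k → ℝ) : G := s.v + D.slope s (x - s.c)

/-- The child of a cell in a given orthant; its value is given by the affine map of the parent. -/
noncomputable def child (s : Cell k G) (σ : Fin k → Bool) : Cell k G :=
  ⟨s.c + s.r • cubeCorner σ, s.v + D.slope s (s.r • cubeCorner σ), D.lam * s.r⟩

/-- The change of slope from a cell to one of its children. -/
noncomputable def jump (s : Cell k G) (σ : Fin k → Bool) : (Fin k → ℝ) →L[ℝ] G :=
  D.slope (D.child s σ) - D.slope s

/-- The correction that turns the affine map of a cell into the one of its child, cut off to the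
orthant of the child. -/
noncomputable def block (s : Cell k G) (σ : Fin k → Bool) (x : Fin k → ℝ) : G :=
  (D.lam * s.r) • D.jump s σ (D.Φ ((D.lam * s.r)⁻¹ • (x - (D.child s σ).c)))

/-- The sum of the corrections of the first `J` generations below a cell. -/
noncomputable def correction : ℕ → Cell k G → (Fin k → ℝ) → G
  | 0, _, _ => 0
  | J + 1, s, x => ∑ σ, (D.block s σ x + correction J (D.child s σ) x)

/-- The approximation that takes `J` generations below a cell into account. -/
noncomputable def approx (J : ℕ) (s : Cell k G) (x : Fin k → ℝ) : G :=
  D.affine s x + D.correction J s x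

/-- The child of a cell in the orthant of `x`. -/
noncomputable def next (x : Fin k → ℝ) (s : Cell k G) : Cell k G :=
  D.child s (signPattern (x - s.c))

lemma approx_zero (s : Cell k G) : D.approx 0 s = D.affine s := by
  funext x; simp [approx, correction]

lemma block_eventuallyEq_zero {s : Cell k G} (hr : 0 < s.r) {σ : Fin k → Bool} {x : Fin k → ℝ}
    (hx : s.r / 2 ≤ ‖x - (D.child s σ).c‖) : D.block s σ =ᶠ[𝓝 x] 0 := by
  have hl := D.lam_pos
  have hc : Continuous fun y : Fin k → ℝ => (D.lam * s.r)⁻¹ • (y - (D.child s σ).c) := by fun_prop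
  have h := D.cutoff.eventuallyEq_zero ((D.lam * s.r)⁻¹ • (x - (D.child s σ).c)) (by
    rw [norm_smul, Real.norm_eq_abs, abs_of_pos (by positivity), ← div_eq_inv_mul,
      le_div_iff₀ (by positivity)]
    refine le_trans (le_of_eq ?_) hx
    field_simp)
  filter_upwards [hc.continuousAt.eventually h] with y hy
  have hy' : D.Φ ((D.lam * s.r)⁻¹ • (y - (D.child s σ).c)) = 0 := hy
  rw [block, hy', map_zero, smul_zero, Pi.zero_apply]

lemma correction_eventuallyEq_zero (J : ℕ) {s : Cell k G} (hr : 0 < s.r) {x : Fin k → ℝ}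
    (hx : s.r ≤ ‖x - s.c‖) : D.correction J s =ᶠ[𝓝 x] 0 := by
  induction J generalizing s with
  | zero => exact Filter.Eventually.of_forall fun y => by simp [correction]
  | succ J ih =>
    have hl := D.lam_pos
    have hl' := D.lam_lt
    have h1 : ∀ σ, s.r / 2 ≤ ‖x - (D.child s σ).c‖ := by
      intro σ
      have h2 := norm_smul_cubeCorner_le hr σ
      have h3 : x - (D.child s σ).c = (x - s.c) - s.r • cubeCorner σ := by simp [child, sub_sub]
      rw [h3]
      linarith [norm_sub_norm_le (x - s.c) (s.r • cubeCorner σ)]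
    have h2 : ∀ σ, D.correction J (D.child s σ) =ᶠ[𝓝 x] 0 := fun σ =>
      ih (by simp only [child]; positivity)
        (le_trans (by simp only [child]; nlinarith) (h1 σ))
    filter_upwards [Filter.eventually_all.2 fun σ => D.block_eventuallyEq_zero hr (h1 σ),
      Filter.eventually_all.2 h2] with y hy1 hy2
    simp [correction, hy1, hy2]

/-- Near a given point only the child in the orthant of that point matters. -/
lemma approx_succ_eventuallyEq (J : ℕ) {s : Cell k G} (hr : 0 < s.r) (x : Fin k → ℝ) :
    D.approx (J + 1) s =ᶠ[𝓝 x] fun y => D.affine s y +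
      (D.block s (signPattern (x - s.c)) y + D.correction J (D.next x s) y) := by
  have hl := D.lam_pos
  have hl' := D.lam_lt
  have h1 : ∀ σ, σ ≠ signPattern (x - s.c) → s.r / 2 ≤ ‖x - (D.child s σ).c‖ := by
    intro σ hσ
    have h3 : x - (D.child s σ).c = (x - s.c) - s.r • cubeCorner σ := by simp [child, sub_sub]
    rw [h3]
    exact half_le_norm_sub_cubeCorner hσ s.r
  have h2 : ∀ σ, σ ≠ signPattern (x - s.c) → D.block s σ =ᶠ[𝓝 x] 0 := fun σ hσ =>
    D.block_eventuallyEq_zero hr (h1 σ hσ)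
  have h3 : ∀ σ, σ ≠ signPattern (x - s.c) → D.correction J (D.child s σ) =ᶠ[𝓝 x] 0 := fun σ hσ =>
    D.correction_eventuallyEq_zero J (by simp only [child]; positivity)
      (le_trans (by simp only [child]; nlinarith) (h1 σ hσ))
  filter_upwards [Filter.eventually_all.2 fun σ => Filter.eventually_all.2 (h2 σ),
    Filter.eventually_all.2 fun σ => Filter.eventually_all.2 (h3 σ)] with y hy2 hy3
  rw [approx, correction, Finset.sum_eq_single (signPattern (x - s.c))]
  · rfl
  · intro σ _ hσ; simp [hy2 σ hσ, hy3 σ hσ]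
  · simp

lemma approx_succ_eventuallyEq_of_le (J : ℕ) {s : Cell k G} (hr : 0 < s.r) {x : Fin k → ℝ}
    (hx : ‖x - (D.next x s).c‖ ≤ (D.next x s).r) :
    D.approx (J + 1) s =ᶠ[𝓝 x] D.approx J (D.next x s) := by
  have hl := D.lam_pos
  set σ := signPattern (x - s.c) with hσ
  have hc : Continuous fun y : Fin k → ℝ => (D.lam * s.r)⁻¹ • (y - (D.child s σ).c) := by fun_prop
  have hlr : 0 < D.lam * s.r := by positivity
  have h := D.cutoff.eventuallyEq_id ((D.lam * s.r)⁻¹ • (x - (D.child s σ).c)) (by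
    rw [norm_smul, Real.norm_eq_abs, abs_of_pos (by positivity), ← div_eq_inv_mul,
      div_le_iff₀ (by positivity), one_mul]
    exact hx)
  filter_upwards [hc.continuousAt.eventually h, D.approx_succ_eventuallyEq J hr x] with y hy1 hy2
  rw [hy2, approx, ← add_assoc]
  congr 1
  have h4 : D.block s σ y = D.jump s σ (y - (D.child s σ).c) := by
    rw [block, hy1, id, map_smul, smul_smul, mul_inv_cancel₀ hlr.ne', one_smul]
  have h5 : D.next x s = D.child s σ := rfl
  rw [h4, h5, jump, affine, affine, sub_apply]
  have h6 : (D.child s σ).v = s.v + D.slope s (s.r • cubeCorner σ) := rfl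
  have h7 : (D.child s σ).c = s.c + s.r • cubeCorner σ := rfl
  have h8 : D.slope s (y - s.c) = D.slope s (s.r • cubeCorner σ) +
      D.slope s (y - (D.child s σ).c) := by
    rw [← map_add, h7]; congr 1; abel
  rw [h6, h8]; abel

lemma approx_succ_eventuallyEq_of_ge (J : ℕ) {s : Cell k G} (hr : 0 < s.r) {x : Fin k → ℝ}
    (hx : (D.next x s).r ≤ ‖x - (D.next x s).c‖) :
    D.approx (J + 1) s =ᶠ[𝓝 x] fun y => D.affine s y + D.block s (signPattern (x - s.c)) y := by
  have hl := D.lam_pos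
  filter_upwards [D.approx_succ_eventuallyEq J hr x,
    D.correction_eventuallyEq_zero J (s := D.next x s)
      (by simp only [next, child]; positivity) hx] with y hy1 hy2
  simp [hy1, hy2]

/-! ### Quantitative bounds -/

/-- Bounds that hold on every cell of the construction. -/
structure Admissible (s : Cell k G) : Prop where
  r_pos : 0 < s.r
  r_le : s.r ≤ 1
  norm_c_add_le : ‖s.c‖ + s.r ≤ 1
  norm_v_add_le : ‖s.v‖ + 2 * s.r ≤ 2

lemma ε_le : D.ε ≤ 1 / 6 := by
  nlinarith [D.ε_small, D.lam_lt, D.ε_nonneg, D.M_nonneg, mul_nonneg D.M_nonneg D.ε_nonneg]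

variable {D}

lemma norm_center_le {k : ℕ} {G : Type*} [NormedAddCommGroup G] {s : Cell k G}
    (hs : Admissible s) : ‖(s.c, s.v)‖ ≤ 2 := by
  rw [Prod.norm_def]
  have := hs.r_pos
  exact max_le (by linarith [hs.norm_c_add_le]) (by linarith [hs.norm_v_add_le])

lemma norm_A_le {p : (Fin k → ℝ) × G} (hp : ‖p‖ ≤ 3) : ‖D.A p‖ ≤ 1 := by
  have h := D.norm_A_sub_le p 0 hp (by simp)
  rw [D.A_zero, sub_zero, sub_zero] at h
  nlinarith [D.ε_le, D.ε_nonneg, norm_nonneg p]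

lemma norm_slope_le {s : Cell k G} (hs : Admissible s) : ‖D.slope s‖ ≤ 2 := by
  have h1 : ‖s.r • D.E‖ ≤ 1 := by
    rw [norm_smul, Real.norm_eq_abs, abs_of_pos hs.r_pos]
    nlinarith [D.norm_E_le, hs.r_le, hs.r_pos, norm_nonneg D.E]
  have h2 : ‖D.A (s.c, s.v)‖ ≤ 1 := norm_A_le ((norm_center_le hs).trans (by norm_num))
  calc ‖D.slope s‖ ≤ ‖D.A (s.c, s.v)‖ + ‖s.r • D.E‖ := norm_add_le _ _
    _ ≤ 2 := by linarith

lemma norm_slope_smul_cubeCorner_le {s : Cell k G} (hs : Admissible s) (σ : Fin k → Bool) :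
    ‖D.slope s (s.r • cubeCorner σ)‖ ≤ s.r := by
  calc _ ≤ ‖D.slope s‖ * ‖s.r • cubeCorner σ‖ := ContinuousLinearMap.le_opNorm _ _
    _ ≤ 2 * (s.r / 2) := mul_le_mul (norm_slope_le hs) (norm_smul_cubeCorner_le hs.r_pos σ)
        (norm_nonneg _) (by norm_num)
    _ = s.r := by ring

lemma Admissible.child {s : Cell k G} (hs : Admissible s) (σ : Fin k → Bool) :
    Admissible (D.child s σ) := by
  have hl := D.lam_pos
  have hl' := D.lam_lt
  have hr := hs.r_pos
  have hr' := hs.r_le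
  refine ⟨?_, ?_, ?_, ?_⟩ <;> simp only [SlopeData.child]
  · positivity
  · nlinarith
  · have := norm_add_le s.c (s.r • cubeCorner σ)
    nlinarith [hs.norm_c_add_le, norm_smul_cubeCorner_le hr σ]
  · have := norm_add_le s.v (D.slope s (s.r • cubeCorner σ))
    nlinarith [hs.norm_v_add_le, norm_slope_smul_cubeCorner_le (D := D) hs σ]

lemma norm_A_child_sub_le {s : Cell k G} (hs : Admissible s) (σ : Fin k → Bool) :
    ‖D.A ((D.child s σ).c, (D.child s σ).v) - D.A (s.c, s.v)‖ ≤ D.ε * s.r := by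
  have h := D.norm_A_sub_le ((D.child s σ).c, (D.child s σ).v) (s.c, s.v)
    ((norm_center_le (hs.child σ)).trans (by norm_num)) ((norm_center_le hs).trans (by norm_num))
  refine h.trans (mul_le_mul_of_nonneg_left ?_ D.ε_nonneg)
  rw [Prod.mk_sub_mk, Prod.norm_def]
  have hr := hs.r_pos
  refine max_le ?_ ?_ <;> simp only [SlopeData.child, add_sub_cancel_left]
  · linarith [norm_smul_cubeCorner_le hr σ]
  · exact norm_slope_smul_cubeCorner_le hs σ

lemma jump_eq (s : Cell k G) (σ : Fin k → Bool) :
    D.jump s σ = (D.A ((D.child s σ).c, (D.child s σ).v) - D.A (s.c, s.v)) -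
      ((1 - D.lam) * s.r) • D.E := by
  have h : (D.child s σ).r = D.lam * s.r := rfl
  rw [jump, slope, slope, h]
  module

lemma norm_jump_le {s : Cell k G} (hs : Admissible s) (σ : Fin k → Bool) :
    ‖D.jump s σ‖ ≤ 2 * s.r := by
  have hl := D.lam_pos
  have hl' := D.lam_lt
  have hr := hs.r_pos
  rw [jump_eq]
  have h1 := norm_A_child_sub_le (D := D) hs σ
  have h2 : ‖((1 - D.lam) * s.r) • D.E‖ ≤ s.r := by
    rw [norm_smul, Real.norm_eq_abs, abs_of_nonneg (mul_nonneg (by linarith) hr.le)]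
    have := D.norm_E_le
    calc (1 - D.lam) * s.r * ‖D.E‖ ≤ 1 * s.r * 1 := by gcongr; linarith
      _ = s.r := by ring
  have h3 := D.ε_le
  refine (norm_sub_le _ _).trans ?_
  nlinarith

lemma norm_block_le {s : Cell k G} (hs : Admissible s) (σ : Fin k → Bool) (x : Fin k → ℝ) :
    ‖D.block s σ x‖ ≤ s.r := by
  have hl := D.lam_pos
  have hr := hs.r_pos
  rw [block, norm_smul, Real.norm_eq_abs, abs_of_pos (by positivity)]
  calc _ ≤ D.lam * s.r * ((2 * s.r) * (1 / (2 * D.lam))) := by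
        gcongr
        exact (ContinuousLinearMap.le_opNorm _ _).trans (mul_le_mul (norm_jump_le hs σ)
          (D.cutoff.norm_le _) (norm_nonneg _) (by positivity))
    _ = s.r * s.r := by field_simp
    _ ≤ s.r := by nlinarith [hs.r_le]

lemma hasFDerivAt_affine (s : Cell k G) (x : Fin k → ℝ) :
    HasFDerivAt (D.affine s) (D.slope s) x := by
  have h := ((D.slope s).hasFDerivAt.comp x ((hasFDerivAt_id x).sub_const s.c)).const_add s.v
  exact h

lemma fderiv_affine (s : Cell k G) : fderiv ℝ (D.affine s) = fun _ => D.slope s :=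
  funext fun x => (hasFDerivAt_affine s x).fderiv

lemma hasFDerivAt_block {s : Cell k G} (hr : 0 < s.r) (σ : Fin k → Bool) (x : Fin k → ℝ) :
    HasFDerivAt (D.block s σ) ((D.jump s σ).comp
      (fderiv ℝ D.Φ ((D.lam * s.r)⁻¹ • (x - (D.child s σ).c)))) x := by
  have hlr : 0 < D.lam * s.r := mul_pos D.lam_pos hr
  have h1 := (((hasFDerivAt_id (𝕜 := ℝ) x).sub_const (D.child s σ).c).const_smul (D.lam * s.r)⁻¹)
  have h2 := (D.cutoff.contDiff.differentiable (by simp)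
    ((D.lam * s.r)⁻¹ • (x - (D.child s σ).c))).hasFDerivAt
  have h3 := ((D.jump s σ).hasFDerivAt.comp x (h2.comp x h1)).const_smul (D.lam * s.r)
  refine h3.congr_fderiv ?_
  ext y
  simp only [smul_apply, ContinuousLinearMap.comp_apply, ContinuousLinearMap.id_apply, map_smul]
  rw [smul_smul, mul_inv_cancel₀ hlr.ne', one_smul]

lemma fderiv_block {s : Cell k G} (hr : 0 < s.r) (σ : Fin k → Bool) :
    fderiv ℝ (D.block s σ) = fun x => (D.jump s σ).comp
      (fderiv ℝ D.Φ ((D.lam * s.r)⁻¹ • (x - (D.child s σ).c))) :=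
  funext fun x => (hasFDerivAt_block hr σ x).fderiv

lemma norm_fderiv_block_le {s : Cell k G} (hs : Admissible s) (σ : Fin k → Bool) (x : Fin k → ℝ) :
    ‖fderiv ℝ (D.block s σ) x‖ ≤ 2 * D.M * s.r := by
  rw [fderiv_block hs.r_pos]
  have hr := hs.r_pos
  calc _ ≤ _ := ContinuousLinearMap.opNorm_comp_le _ _
    _ ≤ (2 * s.r) * D.M := mul_le_mul (norm_jump_le hs σ)
        (D.cutoff.norm_fderiv_le _) (norm_nonneg _) (by positivity)
    _ = _ := by ring

lemma norm_fderiv_fderiv_block_le {s : Cell k G} (hs : Admissible s) (σ : Fin k → Bool)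
    (x : Fin k → ℝ) : ‖fderiv ℝ (fderiv ℝ (D.block s σ)) x‖ ≤ 2 * D.M / D.lam := by
  have hl := D.lam_pos
  have hr := hs.r_pos
  have hM := D.M_nonneg
  rw [fderiv_block hr]
  have h1 := (((hasFDerivAt_id (𝕜 := ℝ) x).sub_const (D.child s σ).c).const_smul (D.lam * s.r)⁻¹)
  have hd : Differentiable ℝ (fderiv ℝ D.Φ) :=
    (D.cutoff.contDiff.fderiv_right (m := 1) (by norm_num)).differentiable (by simp)
  have h2 := (hd ((D.lam * s.r)⁻¹ • (x - (D.child s σ).c))).hasFDerivAt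
  have h3 := (ContinuousLinearMap.compL ℝ (Fin k → ℝ) (Fin k → ℝ) G
    (D.jump s σ)).hasFDerivAt.comp x (h2.comp x h1)
  have h4 : fderiv ℝ (fun x => (D.jump s σ).comp
      (fderiv ℝ D.Φ ((D.lam * s.r)⁻¹ • (x - (D.child s σ).c)))) x = _ := h3.fderiv
  rw [h4]
  refine ContinuousLinearMap.opNorm_le_bound _ (by positivity) fun y => ?_
  simp only [ContinuousLinearMap.comp_apply, smul_apply, ContinuousLinearMap.compL_apply,
    ContinuousLinearMap.id_apply]
  have h5 := D.cutoff.norm_fderiv_fderiv_le ((D.lam * s.r)⁻¹ • (x - (D.child s σ).c))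
  calc _ ≤ ‖D.jump s σ‖ * ‖_‖ := ContinuousLinearMap.opNorm_comp_le _ _
    _ ≤ (2 * s.r) * (D.M * ‖(D.lam * s.r)⁻¹ • y‖) := by
        refine mul_le_mul (norm_jump_le hs σ) ?_ (norm_nonneg _) (by positivity)
        exact (ContinuousLinearMap.le_opNorm _ _).trans (by gcongr)
    _ = 2 * D.M / D.lam * ‖y‖ := by
        rw [norm_smul, Real.norm_eq_abs, abs_of_pos (by positivity)]
        field_simp

lemma contDiff_affine (s : Cell k G) : ContDiff ℝ 2 (D.affine s) := by
  unfold affine; fun_prop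

lemma contDiff_block (s : Cell k G) (σ : Fin k → Bool) : ContDiff ℝ 2 (D.block s σ) := by
  have h := D.cutoff.contDiff.comp
    (f := fun x : Fin k → ℝ => (D.lam * s.r)⁻¹ • (x - (D.child s σ).c)) (by fun_prop)
  exact ((D.jump s σ).contDiff.comp h).const_smul (D.lam * s.r)

lemma contDiff_correction (J : ℕ) (s : Cell k G) : ContDiff ℝ 2 (D.correction J s) := by
  induction J generalizing s with
  | zero => exact contDiff_const
  | succ J ih => exact ContDiff.sum fun σ _ => (contDiff_block s σ).add (ih _)

lemma contDiff_approx (J : ℕ) (s : Cell k G) : ContDiff ℝ 2 (D.approx J s) :=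
  (contDiff_affine s).add (contDiff_correction J s)

lemma Admissible.next {s : Cell k G} (hs : Admissible s) (x : Fin k → ℝ) :
    Admissible (D.next x s) := hs.child _

/-- The second differentials of the approximations stay bounded, because at each point at most one
correction is not affine. -/
lemma norm_fderiv_fderiv_approx_le (J : ℕ) {s : Cell k G} (hs : Admissible s) (x : Fin k → ℝ) :
    ‖fderiv ℝ (fderiv ℝ (D.approx J s)) x‖ ≤ 2 * D.M / D.lam := by
  induction J generalizing s with
  | zero =>
    rw [approx_zero, fderiv_affine]
    have := D.M_nonneg
    have := D.lam_pos
    have h1 : 0 ≤ 2 * D.M / D.lam := by positivity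
    rw [(hasFDerivAt_const (D.slope s) x).fderiv]
    exact (norm_zero (E := (Fin k → ℝ) →L[ℝ] (Fin k → ℝ) →L[ℝ] G)).trans_le h1
  | succ J ih =>
    rcases le_total ‖x - (D.next x s).c‖ (D.next x s).r with h | h
    · rw [(D.approx_succ_eventuallyEq_of_le J hs.r_pos h).fderiv.fderiv_eq]
      exact ih (hs.next x)
    · rw [(D.approx_succ_eventuallyEq_of_ge J hs.r_pos h).fderiv.fderiv_eq]
      have h1 : fderiv ℝ (fun y => D.affine s y + D.block s (signPattern (x - s.c)) y) =
          fun y => D.slope s + fderiv ℝ (D.block s (signPattern (x - s.c))) y :=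
        funext fun y => ((hasFDerivAt_affine s y).add
          ((contDiff_block s _).differentiable (by simp) y).hasFDerivAt).fderiv
      rw [h1, fderiv_const_add]
      exact norm_fderiv_fderiv_block_le hs _ x

/-- The increments of the approximations: near each point an increment is one block or vanishes. -/
lemma exists_block_eventuallyEq (J : ℕ) {s : Cell k G} (hs : Admissible s) (x : Fin k → ℝ) :
    (fun y => D.approx (J + 1) s y - D.approx J s y) =ᶠ[𝓝 x] 0 ∨
      ∃ t σ, Admissible t ∧ t.r = D.lam ^ J * s.r ∧
        (fun y => D.approx (J + 1) s y - D.approx J s y) =ᶠ[𝓝 x] D.block t σ := by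
  induction J generalizing s with
  | zero =>
    refine Or.inr ⟨s, signPattern (x - s.c), hs, by simp, ?_⟩
    filter_upwards [D.approx_succ_eventuallyEq 0 hs.r_pos x] with y hy
    simp [hy, approx_zero, correction]
  | succ J ih =>
    rcases le_total ‖x - (D.next x s).c‖ (D.next x s).r with h | h
    · have h1 := (D.approx_succ_eventuallyEq_of_le (J + 1) hs.r_pos h).sub
        (D.approx_succ_eventuallyEq_of_le J hs.r_pos h)
      rcases ih (hs.next x) with h2 | ⟨t, σ, ht, hr, h2⟩
      · exact Or.inl (h1.trans h2)
      · refine Or.inr ⟨t, σ, ht, ?_, h1.trans h2⟩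
        rw [hr, pow_succ, mul_assoc]; rfl
    · refine Or.inl ?_
      have h1 := (D.approx_succ_eventuallyEq_of_ge (J + 1) hs.r_pos h).sub
        (D.approx_succ_eventuallyEq_of_ge J hs.r_pos h)
      filter_upwards [h1] with y hy
      simpa using hy

lemma norm_approx_succ_sub_le (J : ℕ) {s : Cell k G} (hs : Admissible s) (x : Fin k → ℝ) :
    ‖D.approx (J + 1) s x - D.approx J s x‖ ≤ D.lam ^ J := by
  have hl := pow_pos D.lam_pos J
  rcases D.exists_block_eventuallyEq J hs x with h | ⟨t, σ, ht, hr, h⟩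
  · have := h.self_of_nhds
    simp only at this
    rw [this]; simp [hl.le]
  · have := h.self_of_nhds
    simp only at this
    rw [this]
    refine (norm_block_le ht σ x).trans ?_
    rw [hr]; nlinarith [hs.r_le]

lemma norm_fderiv_approx_succ_sub_le (J : ℕ) {s : Cell k G} (hs : Admissible s) (x : Fin k → ℝ) :
    ‖fderiv ℝ (D.approx (J + 1) s) x - fderiv ℝ (D.approx J s) x‖ ≤ 2 * D.M * D.lam ^ J := by
  have hl := pow_pos D.lam_pos J
  have hM := D.M_nonneg
  have h0 : fderiv ℝ (D.approx (J + 1) s) x - fderiv ℝ (D.approx J s) x =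
      fderiv ℝ (fun y => D.approx (J + 1) s y - D.approx J s y) x :=
    (((contDiff_approx _ s).differentiable (by simp) x).hasFDerivAt.sub
      ((contDiff_approx _ s).differentiable (by simp) x).hasFDerivAt).fderiv.symm
  rw [h0]
  rcases D.exists_block_eventuallyEq J hs x with h | ⟨t, σ, ht, hr, h⟩
  · have h1 : 0 ≤ 2 * D.M * D.lam ^ J := by positivity
    rw [h.fderiv_eq, fderiv_zero]
    simpa using h1
  · rw [h.fderiv_eq]
    refine (norm_fderiv_block_le ht σ x).trans ?_
    rw [hr]
    gcongr
    nlinarith [hs.r_le]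

end SlopeData

/-! ### Passage to the limit -/

/-- A sequence of `C^2` functions that converges geometrically in `C^1`, with bounded second
differentials, has a limit of class `C^{1,1}`. -/
lemma exists_contDiff_limit {F G : Type*} [NormedAddCommGroup F] [NormedSpace ℝ F]
    [NormedAddCommGroup G] [NormedSpace ℝ G] [CompleteSpace G] {g : ℕ → F → G} {C q : ℝ} {L : ℝ≥0}
    (hg : ∀ n, ContDiff ℝ 2 (g n)) (hq0 : 0 ≤ q) (hq : q < 1)
    (h0 : ∀ n x, ‖g (n + 1) x - g n x‖ ≤ C * q ^ n)
    (h1 : ∀ n x, ‖fderiv ℝ (g (n + 1)) x - fderiv ℝ (g n) x‖ ≤ C * q ^ n)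
    (h2 : ∀ n x, ‖fderiv ℝ (fderiv ℝ (g n)) x‖ ≤ L) :
    ∃ f : F → G, ContDiff ℝ 1 f ∧ LipschitzWith L (fderiv ℝ f) ∧
      (∀ x, Filter.Tendsto (fun n => g n x) Filter.atTop (𝓝 (f x))) ∧
      ∀ x, Filter.Tendsto (fun n => fderiv ℝ (g n) x) Filter.atTop (𝓝 (fderiv ℝ f x)) := by
  have hd0 : ∀ x n, dist (g n x) (g (n + 1) x) ≤ C * q ^ n := fun x n => by
    rw [dist_comm, dist_eq_norm]; exact h0 n x
  have hd1 : ∀ x n, dist (fderiv ℝ (g n) x) (fderiv ℝ (g (n + 1)) x) ≤ C * q ^ n := fun x n => by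
    rw [dist_comm, dist_eq_norm]; exact h1 n x
  choose f hf using fun x =>
    cauchySeq_tendsto_of_complete (cauchySeq_of_le_geometric q C hq (hd0 x))
  choose f' hf' using fun x =>
    cauchySeq_tendsto_of_complete (cauchySeq_of_le_geometric q C hq (hd1 x))
  have hlim : Filter.Tendsto (fun n : ℕ => C * q ^ n / (1 - q)) Filter.atTop (𝓝 0) := by
    simpa using ((tendsto_pow_atTop_nhds_zero_of_lt_one hq0 hq).const_mul C).div_const (1 - q)
  have hunif : TendstoUniformly (fun n => fderiv ℝ (g n)) f' Filter.atTop := by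
    rw [Metric.tendstoUniformly_iff]
    intro e he
    filter_upwards [hlim.eventually (gt_mem_nhds he)] with n hn x
    rw [dist_comm]
    exact (dist_le_of_le_geometric_of_tendsto q C hq (hd1 x) (hf' x) n).trans_lt hn
  have hder : ∀ x, HasFDerivAt f (f' x) x := hasFDerivAt_of_tendstoUniformly hunif
    (fun n x => ((hg n).differentiable (by simp) x).hasFDerivAt) hf
  have hfd : fderiv ℝ f = f' := funext fun x => (hder x).fderiv
  have hlip : LipschitzWith L f' := by
    refine LipschitzWith.of_dist_le_mul fun x y => ?_
    refine le_of_tendsto ((hf' x).dist (hf' y)) (Filter.Eventually.of_forall fun n => ?_)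
    have h3 : Differentiable ℝ (fderiv ℝ (g n)) :=
      ((hg n).fderiv_right (m := 1) (by norm_num)).differentiable (by simp)
    exact (lipschitzWith_of_nnnorm_fderiv_le h3 fun x => h2 n x).dist_le_mul x y
  refine ⟨f, contDiff_one_iff_fderiv.2 ⟨fun x => (hder x).differentiableAt, ?_⟩, ?_, hf, ?_⟩
  · rw [hfd]; exact hlip.continuous
  · rw [hfd]; exact hlip
  · rw [hfd]; exact hf'

/-! ### The function that is tangent exactly on the dust -/

namespace SlopeData

variable {k : ℕ} {G : Type*} [NormedAddCommGroup G] [NormedSpace ℝ G] (D : SlopeData k G)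

/-- The cell with centre `0`, half-side `1` and value `0`. -/
def root : Cell k G := ⟨0, 0, 1⟩

/-- The cell of the `n`-th generation selected by the point `x`. -/
noncomputable def cell (x : Fin k → ℝ) (n : ℕ) : Cell k G := (D.next x)^[n] root

lemma cell_succ (x : Fin k → ℝ) (n : ℕ) : D.cell x (n + 1) = D.next x (D.cell x n) := by
  rw [cell, Function.iterate_succ_apply', cell]

lemma cell_r (x : Fin k → ℝ) (n : ℕ) : (D.cell x n).r = D.lam ^ n := by
  induction n with
  | zero => rfl
  | succ n ih => rw [cell_succ, pow_succ', ← ih]; rfl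

lemma cell_c (x : Fin k → ℝ) (n : ℕ) : (D.cell x n).c = cubeCenter D.lam x n := by
  induction n with
  | zero => rfl
  | succ n ih => rw [cell_succ, cubeCenter, ← ih, ← cell_r]; rfl

lemma admissible_root {k : ℕ} {G : Type*} [NormedAddCommGroup G] :
    Admissible (root : Cell k G) :=
  ⟨by simp [root], by simp [root], by simp [root], by simp [root]⟩

lemma admissible_cell (x : Fin k → ℝ) (n : ℕ) : Admissible (D.cell x n) := by
  induction n with
  | zero => exact admissible_root
  | succ n ih => rw [cell_succ]; exact ih.next x

/-- As long as `x` stays in its cells, the approximations are near `x` those of the cells. -/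
lemma approx_root_eventuallyEq {x : Fin k → ℝ} {n : ℕ}
    (hx : ∀ j ≤ n, ‖x - (D.cell x j).c‖ ≤ (D.cell x j).r) (J : ℕ) :
    D.approx (J + n) root =ᶠ[𝓝 x] D.approx J (D.cell x n) := by
  induction n generalizing J with
  | zero => exact Filter.EventuallyEq.rfl
  | succ n ih =>
    have h1 := ih (fun j hj => hx j (by omega)) (J + 1)
    have h2 := hx (n + 1) le_rfl
    rw [cell_succ] at h2 ⊢
    have h3 := D.approx_succ_eventuallyEq_of_le J (D.admissible_cell x n).r_pos h2
    rw [show J + (n + 1) = J + 1 + n by ring]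
    exact h1.trans h3

variable {D}

lemma norm_slope_sub_le {s : Cell k G} (hs : Admissible s) {x : Fin k → ℝ}
    (hx : ‖x - s.c‖ ≤ s.r) : ‖D.slope s (x - s.c)‖ ≤ 2 * s.r :=
  (ContinuousLinearMap.le_opNorm _ _).trans
    (mul_le_mul (norm_slope_le hs) hx (norm_nonneg _) (by norm_num))

variable {f : (Fin k → ℝ) → G}

/-- At the points of the dust the limit function has the prescribed differential. -/
lemma fderiv_eq_of_forall_mem
    (hf : ∀ x, Filter.Tendsto (fun n => D.approx n root x) Filter.atTop (𝓝 (f x)))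
    (hf' : ∀ x, Filter.Tendsto (fun n => fderiv ℝ (D.approx n root) x) Filter.atTop
      (𝓝 (fderiv ℝ f x)))
    {x : Fin k → ℝ} (hx : ∀ j, ‖x - (D.cell x j).c‖ ≤ (D.cell x j).r) :
    ‖f x‖ ≤ 2 ∧ fderiv ℝ f x = D.A (x, f x) := by
  have hev : ∀ n, D.approx n root =ᶠ[𝓝 x] D.affine (D.cell x n) := fun n => by
    have := D.approx_root_eventuallyEq (fun j (_ : j ≤ n) => hx j) 0
    rwa [zero_add, approx_zero] at this
  have hr : Filter.Tendsto (fun n => (D.cell x n).r) Filter.atTop (𝓝 0) := by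
    simp only [cell_r]
    exact tendsto_pow_atTop_nhds_zero_of_lt_one D.lam_pos.le (D.lam_lt.trans (by norm_num))
  have hc : Filter.Tendsto (fun n => (D.cell x n).c) Filter.atTop (𝓝 x) := by
    rw [tendsto_iff_norm_sub_tendsto_zero]
    refine squeeze_zero (fun _ => norm_nonneg _) (fun n => ?_) hr
    rw [norm_sub_rev]; exact hx n
  have hv : Filter.Tendsto (fun n => (D.cell x n).v) Filter.atTop (𝓝 (f x)) := by
    have h1 : Filter.Tendsto (fun n => D.slope (D.cell x n) (x - (D.cell x n).c)) Filter.atTop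
        (𝓝 0) :=
      squeeze_zero_norm (fun n => norm_slope_sub_le (D.admissible_cell x n) (hx n))
        (by simpa using hr.const_mul 2)
    have h2 := (hf x).sub h1
    rw [sub_zero] at h2
    refine h2.congr fun n => ?_
    rw [(hev n).self_of_nhds, affine, add_sub_cancel_right]
  have hle : ‖(x, f x)‖ ≤ 2 := le_of_tendsto (hc.prodMk_nhds hv).norm
    (Filter.Eventually.of_forall fun n => norm_center_le (D.admissible_cell x n))
  refine ⟨(le_max_right _ _).trans hle, tendsto_nhds_unique (hf' x) ?_⟩
  have hA : Filter.Tendsto (fun n => D.A ((D.cell x n).c, (D.cell x n).v)) Filter.atTop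
      (𝓝 (D.A (x, f x))) := by
    rw [tendsto_iff_norm_sub_tendsto_zero]
    refine squeeze_zero (fun _ => norm_nonneg _) (fun n => D.norm_A_sub_le _ _
      ((norm_center_le (D.admissible_cell x n)).trans (by norm_num)) (hle.trans (by norm_num))) ?_
    simpa using (tendsto_iff_norm_sub_tendsto_zero.1 (hc.prodMk_nhds hv)).const_mul D.ε
  have h3 := hA.add (hr.smul_const D.E)
  rw [zero_smul, add_zero] at h3
  refine h3.congr fun n => ?_
  rw [(hev n).fderiv_eq, fderiv_affine, slope]

/-- Where the point leaves its cells, the tilt in the direction of `E` dominates the variation of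
the prescribed differential, so that the limit function is not tangent. -/
lemma fderiv_ne_of_exit
    (hf : ∀ x, Filter.Tendsto (fun n => D.approx n root x) Filter.atTop (𝓝 (f x)))
    (hf' : ∀ x, Filter.Tendsto (fun n => fderiv ℝ (D.approx n root) x) Filter.atTop
      (𝓝 (fderiv ℝ f x)))
    {x : Fin k → ℝ} {n : ℕ} (hx : ∀ j ≤ n, ‖x - (D.cell x j).c‖ ≤ (D.cell x j).r)
    (hexit : (D.cell x (n + 1)).r < ‖x - (D.cell x (n + 1)).c‖) :
    ‖f x‖ ≤ 3 ∧ fderiv ℝ f x ≠ D.A (x, f x) := by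
  set s := D.cell x n with hsdef
  have hs : Admissible s := D.admissible_cell x n
  have hr := hs.r_pos
  have hl := D.lam_pos
  have hl' := D.lam_lt
  have hxs : ‖x - s.c‖ ≤ s.r := hx n le_rfl
  set σ := signPattern (x - s.c) with hσ
  rw [cell_succ] at hexit
  have hev : ∀ J, D.approx (J + 1 + n) root =ᶠ[𝓝 x] fun y => D.affine s y + D.block s σ y :=
    fun J => (D.approx_root_eventuallyEq hx (J + 1)).trans
      (D.approx_succ_eventuallyEq_of_ge J hr hexit.le)
  have hshift : Filter.Tendsto (fun J : ℕ => J + 1 + n) Filter.atTop Filter.atTop :=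
    Filter.tendsto_atTop_mono (fun J => by show J ≤ J + 1 + n; omega) Filter.tendsto_id
  have hfx : f x = D.affine s x + D.block s σ x := by
    refine tendsto_nhds_unique ((hf x).comp hshift) (tendsto_const_nhds.congr fun J => ?_)
    exact (hev J).self_of_nhds.symm
  set P := fderiv ℝ D.Φ ((D.lam * s.r)⁻¹ • (x - (D.child s σ).c)) with hP
  have hdfx : fderiv ℝ f x = D.slope s + (D.jump s σ).comp P := by
    refine tendsto_nhds_unique ((hf' x).comp hshift) (tendsto_const_nhds.congr fun J => ?_)
    show _ = fderiv ℝ (D.approx (J + 1 + n) root) x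
    rw [(hev J).fderiv_eq]
    exact ((hasFDerivAt_affine s x).add (hasFDerivAt_block hr σ x)).fderiv.symm
  have hfv : ‖f x - s.v‖ ≤ 3 * s.r := by
    have h1 : f x - s.v = D.slope s (x - s.c) + D.block s σ x := by
      rw [hfx, affine]; abel
    rw [h1]
    refine (norm_add_le _ _).trans ?_
    linarith [norm_slope_sub_le (D := D) hs hxs, norm_block_le (D := D) hs σ x]
  have hf3 : ‖f x‖ ≤ 3 := by
    have := norm_sub_norm_le (f x) s.v
    linarith [hs.norm_v_add_le, hs.r_le]
  refine ⟨hf3, fun heq => ?_⟩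
  have hx3 : ‖(x, f x)‖ ≤ 3 := by
    refine max_le ?_ hf3
    have := norm_sub_norm_le x s.c
    simp only
    linarith [hs.norm_c_add_le]
  have hA : ‖D.A (x, f x) - D.A (s.c, s.v)‖ ≤ D.ε * (3 * s.r) := by
    refine (D.norm_A_sub_le _ _ hx3 ((norm_center_le hs).trans (by norm_num))).trans ?_
    refine mul_le_mul_of_nonneg_left ?_ D.ε_nonneg
    rw [Prod.mk_sub_mk]
    exact max_le (hxs.trans (by linarith)) hfv
  set u : Fin k → ℝ := Pi.single D.i₀ 1 with hu
  have hu1 : ‖u‖ = 1 := by simp [hu, Pi.norm_single]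
  set B := D.A ((D.child s σ).c, (D.child s σ).v) - D.A (s.c, s.v) with hB
  have hBn : ‖B‖ ≤ D.ε * s.r := norm_A_child_sub_le hs σ
  -- Test both differentials on the `i₀`-th basis vector and with the functional `η`.
  have key : D.η ((D.A (x, f x) - D.A (s.c, s.v)) u) =
      s.r + D.η (B (P u)) - (1 - D.lam) * s.r * P u D.i₀ := by
    rw [← heq, hdfx, slope, jump_eq]
    simp only [add_apply, sub_apply, smul_apply, ContinuousLinearMap.comp_apply, map_add, map_sub,
      map_smul, smul_eq_mul, D.η_E]
    simp [hu, hB]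
    ring
  have hη : ∀ z : G, |D.η z| ≤ ‖z‖ := fun z => by
    have h1 := D.η.le_opNorm z
    rw [Real.norm_eq_abs] at h1
    nlinarith [D.norm_η_le, norm_nonneg z]
  have e1 : D.η ((D.A (x, f x) - D.A (s.c, s.v)) u) ≤ D.ε * (3 * s.r) := by
    refine (le_abs_self _).trans ((hη _).trans ?_)
    have := (D.A (x, f x) - D.A (s.c, s.v)).le_opNorm u
    rw [hu1, mul_one] at this
    exact this.trans hA
  have e2 : -(D.ε * s.r * D.M) ≤ D.η (B (P u)) := by
    refine neg_le_of_abs_le ((hη _).trans ?_)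
    have h1 : ‖P u‖ ≤ D.M := by
      have := P.le_opNorm u
      rw [hu1, mul_one] at this
      exact this.trans (D.cutoff.norm_fderiv_le _)
    exact (B.le_opNorm _).trans (mul_le_mul hBn h1 (norm_nonneg _)
      (mul_nonneg D.ε_nonneg hr.le))
  have e3 : P u D.i₀ ≤ 1 := D.cutoff.fderiv_apply_le _
  have e4 : (1 - D.lam) * s.r * P u D.i₀ ≤ (1 - D.lam) * s.r * 1 :=
    mul_le_mul_of_nonneg_left e3 (mul_nonneg (by linarith) hr.le)
  have e5 : (3 + D.M) * D.ε * s.r < D.lam * s.r := mul_lt_mul_of_pos_right D.ε_small hr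
  nlinarith

lemma mem_cantorDust_iff {x : Fin k → ℝ} :
    x ∈ cantorDust k D.lam ↔ ∀ j, ‖x - (D.cell x j).c‖ ≤ (D.cell x j).r := by
  simp only [cell_r, cell_c]; rfl

variable (D)

/-- The limit of the approximations below the root cell is tangent to `A` over the unit cube exactly
at the points of the dust. -/
lemma exists_function [CompleteSpace G] : ∃ f : (Fin k → ℝ) → G, ContDiff ℝ 1 f ∧
    (∃ L : ℝ≥0, LipschitzWith L (fderiv ℝ f)) ∧ ∀ x, ‖x‖ ≤ 1 →
      ‖f x‖ ≤ 3 ∧ (fderiv ℝ f x = D.A (x, f x) ↔ x ∈ cantorDust k D.lam) := by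
  have hM := D.M_nonneg
  have hl := D.lam_pos
  have hl' := D.lam_lt
  obtain ⟨f, hf1, hL, hf, hf'⟩ := exists_contDiff_limit (g := fun n => D.approx n root)
    (C := max 1 (2 * D.M)) (q := D.lam) (L := (2 * D.M / D.lam).toNNReal)
    (fun n => contDiff_approx n _) hl.le (by linarith)
    (fun n x => (norm_approx_succ_sub_le n admissible_root x).trans
      (le_mul_of_one_le_left (by positivity) (le_max_left _ _)))
    (fun n x => (norm_fderiv_approx_succ_sub_le n admissible_root x).trans
      (mul_le_mul_of_nonneg_right (le_max_right _ _) (by positivity)))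
    (fun n x => (norm_fderiv_fderiv_approx_le n admissible_root x).trans (Real.le_coe_toNNReal _))
  refine ⟨f, hf1, ⟨_, hL⟩, fun x hx => ?_⟩
  by_cases hK : x ∈ cantorDust k D.lam
  · obtain ⟨h1, h2⟩ := fderiv_eq_of_forall_mem hf hf' (mem_cantorDust_iff.1 hK)
    exact ⟨h1.trans (by norm_num), by simp [hK, h2]⟩
  · have h := mt mem_cantorDust_iff.2 hK
    push Not at h
    classical
    -- The first generation that `x` leaves is positive, since `x` lies in the root cell.
    obtain ⟨n, hn⟩ : ∃ n, Nat.find h = n + 1 := by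
      refine Nat.exists_eq_succ_of_ne_zero fun h0 => ?_
      have := Nat.find_spec h
      rw [h0] at this
      simp only [cell, Function.iterate_zero, id, root, sub_zero] at this
      linarith
    obtain ⟨h1, h2⟩ := fderiv_ne_of_exit hf hf' (x := x) (n := n)
      (fun j hj => not_lt.1 (Nat.find_min h (by omega))) (hn ▸ Nat.find_spec h)
    exact ⟨h1, by simp [hK, h2]⟩

end SlopeData

/-- For a field `A` of differentials with small Lipschitz constant that vanishes at the origin there
is a function of class `C^{1,1}` whose differential agrees with `A` along its graph exactly over the
dust of ratio `lam`. -/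
theorem exists_fderiv_eq_iff_mem_cantorDust {k : ℕ} (i₀ : Fin k) (G : Type*) [NormedAddCommGroup G]
    [NormedSpace ℝ G] [CompleteSpace G] [Nontrivial G] {lam : ℝ} (h0 : 0 < lam)
    (h1 : lam < 1 / 2) : ∃ ε : ℝ≥0, 0 < ε ∧ ∀ A : (Fin k → ℝ) × G → (Fin k → ℝ) →L[ℝ] G,
      LipschitzOnWith ε A (Metric.closedBall 0 3) → A 0 = 0 →
      ∃ f : (Fin k → ℝ) → G, ContDiff ℝ 1 f ∧ (∃ L : ℝ≥0, LipschitzWith L (fderiv ℝ f)) ∧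
        ∀ x, ‖x‖ ≤ 1 → ‖f x‖ ≤ 3 ∧ (fderiv ℝ f x = A (x, f x) ↔ x ∈ cantorDust k lam) := by
  obtain ⟨M, Φ, hM, hΦ⟩ := exists_isCutoffId i₀ (ρ := 1 / (2 * lam))
    (by rw [lt_div_iff₀ (by positivity)]; linarith)
  obtain ⟨e, he⟩ := exists_norm_eq G zero_le_one
  obtain ⟨η, hη1, hη2⟩ := exists_dual_vector ℝ e (by rw [he]; exact one_ne_zero)
  have hpos : 0 < lam / (2 * (3 + M)) := by positivity
  refine ⟨(lam / (2 * (3 + M))).toNNReal, Real.toNNReal_pos.2 hpos, fun A hA hA0 => ?_⟩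
  exact SlopeData.exists_function
    { i₀ := i₀
      A := A
      E := (ContinuousLinearMap.proj i₀ : (Fin k → ℝ) →L[ℝ] ℝ).smulRight e
      η := η
      lam := lam
      M := M
      ε := lam / (2 * (3 + M))
      Φ := Φ
      lam_pos := h0
      lam_lt := h1
      M_nonneg := hM
      ε_nonneg := hpos.le
      ε_small := by
        have : (3 + M) * (lam / (2 * (3 + M))) = lam / 2 := by field_simp
        linarith
      cutoff := hΦ
      norm_A_sub_le := fun p q hp hq => by
        have := hA.dist_le_mul p (by simpa using hp) q (by simpa using hq)
        rwa [dist_eq_norm, dist_eq_norm, Real.coe_toNNReal _ hpos.le] at this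
      A_zero := hA0
      norm_E_le := by
        refine ContinuousLinearMap.opNorm_le_bound _ zero_le_one fun x => ?_
        simp only [ContinuousLinearMap.smulRight_apply, ContinuousLinearMap.proj_apply, norm_smul,
          he, mul_one, one_mul]
        exact norm_le_pi_norm x i₀
      norm_η_le := hη1.le
      η_E := fun x => by simp [hη2, he] }

/-! ### Hausdorff dimension of the dust -/

/-- The centre of the cube of the `n`-th generation with the address `ω`. -/
noncomputable def cornerSum {k : ℕ} (lam : ℝ) (ω : ℕ → Fin k → Bool) (n : ℕ) : Fin k → ℝ :=
  ∑ j ∈ Finset.range n, lam ^ j • cubeCorner (ω j)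

/-- The address of the cubes selected by the point `x`. -/
noncomputable def address {k : ℕ} (lam : ℝ) (x : Fin k → ℝ) (n : ℕ) : Fin k → Bool :=
  signPattern (x - cubeCenter lam x n)

/-- The point with the address `ω`. -/
noncomputable def addressPoint {k : ℕ} (lam : ℝ) (ω : ℕ → Fin k → Bool) : Fin k → ℝ :=
  ∑' j, lam ^ j • cubeCorner (ω j)

section Address

variable {k : ℕ} {lam : ℝ}

lemma cubeCenter_eq_cornerSum (x : Fin k → ℝ) (n : ℕ) :
    cubeCenter lam x n = cornerSum lam (address lam x) n := by
  induction n with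
  | zero => simp [cubeCenter, cornerSum]
  | succ n ih =>
    have h : cubeCenter lam x (n + 1) =
      cubeCenter lam x n + lam ^ n • cubeCorner (address lam x n) := rfl
    rw [h, ih, cornerSum, cornerSum, Finset.sum_range_succ]

lemma cornerSum_succ (ω : ℕ → Fin k → Bool) (n : ℕ) :
    cornerSum lam ω (n + 1) = cornerSum lam ω n + lam ^ n • cubeCorner (ω n) :=
  Finset.sum_range_succ _ _

lemma dist_cornerSum_succ_le (h0 : 0 < lam) (ω : ℕ → Fin k → Bool) (n : ℕ) :
    dist (cornerSum lam ω n) (cornerSum lam ω (n + 1)) ≤ 1 / 2 * lam ^ n := by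
  rw [dist_comm, dist_eq_norm, cornerSum_succ, add_sub_cancel_left]
  have := norm_smul_cubeCorner_le (k := k) (pow_pos h0 n) (ω n)
  linarith

lemma tendsto_cornerSum (h0 : 0 < lam) (h1 : lam < 1) (ω : ℕ → Fin k → Bool) :
    Filter.Tendsto (cornerSum lam ω) Filter.atTop (𝓝 (addressPoint lam ω)) := by
  have hs : Summable fun j => lam ^ j • cubeCorner (ω j) := by
    refine Summable.of_norm_bounded (g := fun j => lam ^ j)
      (summable_geometric_of_lt_one h0.le h1) fun j => ?_
    have := norm_smul_cubeCorner_le (k := k) (pow_pos h0 j) (ω j)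
    have := pow_pos h0 j
    linarith
  exact hs.hasSum.tendsto_sum_nat

lemma norm_addressPoint_sub_le (h0 : 0 < lam) (h1 : lam < 1) (ω : ℕ → Fin k → Bool) (n : ℕ) :
    ‖addressPoint lam ω - cornerSum lam ω n‖ ≤ 1 / 2 * lam ^ n / (1 - lam) := by
  rw [← dist_eq_norm, dist_comm]
  exact dist_le_of_le_geometric_of_tendsto lam (1 / 2) h1 (dist_cornerSum_succ_le h0 ω)
    (tendsto_cornerSum h0 h1 ω) n

lemma norm_addressPoint_sub_le' (h0 : 0 < lam) (h1 : lam ≤ 1 / 2) (ω : ℕ → Fin k → Bool) (n : ℕ) :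
    ‖addressPoint lam ω - cornerSum lam ω n‖ ≤ lam ^ n := by
  refine (norm_addressPoint_sub_le h0 (by linarith) ω n).trans ?_
  rw [div_le_iff₀ (by linarith)]
  nlinarith [pow_pos h0 n]

/-- A point of the dust is the point with its address. -/
lemma addressPoint_address (h0 : 0 < lam) (h1 : lam < 1) {x : Fin k → ℝ}
    (hx : x ∈ cantorDust k lam) : addressPoint lam (address lam x) = x := by
  refine tendsto_nhds_unique (tendsto_cornerSum h0 h1 _) ?_
  rw [tendsto_iff_norm_sub_tendsto_zero]
  refine squeeze_zero (fun _ => norm_nonneg _) (fun n => ?_)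
    (tendsto_pow_atTop_nhds_zero_of_lt_one h0.le h1)
  rw [norm_sub_rev, ← cubeCenter_eq_cornerSum]
  exact hx n

lemma signPattern_smul_add {r : ℝ} (σ : Fin k → Bool) {z : Fin k → ℝ}
    (hz : ‖z‖ < r / 2) : signPattern (r • cubeCorner σ + z) = σ := by
  funext i
  have hi := (norm_le_pi_norm z i).trans_lt hz
  rw [Real.norm_eq_abs, abs_lt] at hi
  cases h : σ i <;> simp [signPattern, cubeCorner, h] <;> linarith

/-- If the ratio is less than `1/2`, then every address is the address of its point. -/
lemma address_addressPoint (h0 : 0 < lam) (h1 : lam < 1 / 2) (ω : ℕ → Fin k → Bool) (n : ℕ) :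
    address lam (addressPoint lam ω) n = ω n ∧
      cubeCenter lam (addressPoint lam ω) n = cornerSum lam ω n := by
  have key : ∀ n, cubeCenter lam (addressPoint lam ω) n = cornerSum lam ω n →
      address lam (addressPoint lam ω) n = ω n := by
    intro n hn
    have h2 := norm_addressPoint_sub_le h0 (by linarith) ω (n + 1)
    have h3 : addressPoint lam ω - cubeCenter lam (addressPoint lam ω) n =
        lam ^ n • cubeCorner (ω n) + (addressPoint lam ω - cornerSum lam ω (n + 1)) := by
      rw [hn, cornerSum_succ]; abel
    rw [address, h3]
    refine signPattern_smul_add _ (h2.trans_lt ?_)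
    rw [div_lt_iff₀ (by linarith), pow_succ]
    nlinarith [pow_pos h0 n]
  induction n with
  | zero => exact ⟨key 0 (by simp [cubeCenter, cornerSum]), by simp [cubeCenter, cornerSum]⟩
  | succ n ih =>
    have h2 : cubeCenter lam (addressPoint lam ω) (n + 1) = cornerSum lam ω (n + 1) := by
      have h : cubeCenter lam (addressPoint lam ω) (n + 1) = cubeCenter lam (addressPoint lam ω) n +
        lam ^ n • cubeCorner (address lam (addressPoint lam ω) n) := rfl
      rw [h, ih.1, ih.2, cornerSum_succ]
    exact ⟨key _ h2, h2⟩

lemma addressPoint_mem_cantorDust (h0 : 0 < lam) (h1 : lam < 1 / 2) (ω : ℕ → Fin k → Bool) :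
    addressPoint lam ω ∈ cantorDust k lam := fun n => by
  rw [(address_addressPoint h0 h1 ω n).2]
  exact norm_addressPoint_sub_le' h0 h1.le ω n

/-- For the ratio `1/2` the dust is the whole cube. -/
lemma mem_cantorDust_half {x : Fin k → ℝ} (hx : ‖x‖ ≤ 1) : x ∈ cantorDust k (1 / 2) := by
  intro n
  induction n with
  | zero => simpa [cubeCenter] using hx
  | succ n ih =>
    rw [pi_norm_le_iff_of_nonneg (by positivity)] at ih ⊢
    intro i
    have h := ih i
    rw [cubeCenter, pow_succ]
    simp only [Pi.sub_apply, Pi.add_apply, Pi.smul_apply, smul_eq_mul, cubeCorner, signPattern,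
      Real.norm_eq_abs, abs_le] at h ⊢
    by_cases hz : 0 ≤ x i - cubeCenter (1 / 2) x n i
    · simp only [hz, decide_true, if_true]; constructor <;> linarith
    · simp only [hz, decide_false, Bool.false_eq_true, if_false]; constructor <;> linarith

lemma cornerSum_congr {ω ω' : ℕ → Fin k → Bool} {n : ℕ} (h : ∀ j < n, ω j = ω' j) :
    cornerSum lam ω n = cornerSum lam ω' n :=
  Finset.sum_congr rfl fun j hj => by rw [h j (Finset.mem_range.1 hj)]

/-- Two points of the dust whose addresses differ first at the index `n` have a distance
comparable to `lam ^ n`. -/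
lemma le_norm_addressPoint_sub (h0 : 0 < lam) (h1 : lam < 1 / 2) {ω ω' : ℕ → Fin k → Bool} {n : ℕ}
    (h : ∀ j < n, ω j = ω' j) (hn : ω n ≠ ω' n) :
    (1 - 2 * lam) * lam ^ n ≤ ‖addressPoint lam ω - addressPoint lam ω'‖ := by
  obtain ⟨i, hi⟩ := Function.ne_iff.1 hn
  have h2 := (norm_le_pi_norm _ i).trans (norm_addressPoint_sub_le' h0 h1.le ω (n + 1))
  have h3 := (norm_le_pi_norm _ i).trans (norm_addressPoint_sub_le' h0 h1.le ω' (n + 1))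
  refine le_trans ?_ (norm_le_pi_norm _ i)
  rw [cornerSum_succ, pow_succ] at h2 h3
  rw [← cornerSum_congr h] at h3
  simp only [Pi.sub_apply, Pi.add_apply, Pi.smul_apply, smul_eq_mul, cubeCorner,
      Real.norm_eq_abs, abs_le] at h2 h3 ⊢
  cases hω : ω n i <;> cases hω' : ω' n i
  · exact absurd (hω.trans hω'.symm) hi
  · refine le_trans ?_ (neg_le_abs _)
    simp only [hω, hω', if_true, Bool.false_eq_true, if_false] at h2 h3
    linarith [h2.2, h3.1]
  · refine le_trans ?_ (le_abs_self _)
    simp only [hω, hω', if_true, Bool.false_eq_true, if_false] at h2 h3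
    linarith [h2.1, h3.2]
  · exact absurd (hω.trans hω'.symm) hi

/-- The lower bound: reading an address with the ratio `1/2` instead of `lam` is a Hölder map of the
dust onto the cube. -/
lemma le_dimH_cantorDust (h0 : 0 < lam) (h1 : lam < 1 / 2) {s : ℝ≥0} (hs : 0 < s)
    (hls : lam ^ (s : ℝ) = 1 / 2) : ((k : ℝ≥0∞) * s) ≤ dimH (cantorDust k lam) := by
  set π : (Fin k → ℝ) → (Fin k → ℝ) := fun x => addressPoint (1 / 2) (address lam x) with hπ
  have hgap : 0 < 1 - 2 * lam := by linarith
  have hC : 0 < 2 / (1 - 2 * lam) ^ (s : ℝ) := by positivity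
  have hhol : HolderOnWith (2 / (1 - 2 * lam) ^ (s : ℝ)).toNNReal s π (cantorDust k lam) := by
    intro x hx y hy
    rw [edist_dist, edist_dist, ENNReal.ofReal_rpow_of_nonneg dist_nonneg s.coe_nonneg]
    change _ ≤ ENNReal.ofReal (2 / (1 - 2 * lam) ^ (s : ℝ)) * _
    rw [← ENNReal.ofReal_mul hC.le]
    refine ENNReal.ofReal_le_ofReal ?_
    by_cases heq : ∀ n, address lam x n = address lam y n
    · have : π x = π y := by simp only [hπ]; rw [funext heq]
      rw [this, dist_self]; positivity
    · push Not at heq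
      classical
      set n := Nat.find heq
      have hn : address lam x n ≠ address lam y n := Nat.find_spec heq
      have hlt : ∀ j < n, address lam x j = address lam y j := fun j hj =>
        not_not.1 (Nat.find_min heq hj)
      have h2 := le_norm_addressPoint_sub h0 h1 hlt hn
      rw [addressPoint_address h0 (by linarith) hx, addressPoint_address h0 (by linarith) hy,
        ← dist_eq_norm] at h2
      have h3 : dist (π x) (π y) ≤ 2 * (1 / 2) ^ n := by
        have h4 := norm_addressPoint_sub_le' (by norm_num) le_rfl (address lam x) n
        have h5 := norm_addressPoint_sub_le' (by norm_num) le_rfl (address lam y) n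
        rw [← cornerSum_congr hlt] at h5
        rw [← dist_eq_norm] at h4 h5
        have := dist_triangle_right (π x) (π y) (cornerSum (1 / 2) (address lam x) n)
        linarith
      have h6 : ((1 / 2 : ℝ)) ^ n = (lam ^ n) ^ (s : ℝ) := by
        rw [← hls, ← Real.rpow_natCast, ← Real.rpow_natCast, ← Real.rpow_mul h0.le,
          ← Real.rpow_mul h0.le, mul_comm]
      have h7 : ((1 - 2 * lam) * lam ^ n) ^ (s : ℝ) ≤ dist x y ^ (s : ℝ) :=
        Real.rpow_le_rpow (by positivity) h2 s.coe_nonneg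
      rw [Real.mul_rpow hgap.le (by positivity), ← h6] at h7
      refine h3.trans ?_
      rw [div_mul_eq_mul_div, le_div_iff₀ (by positivity)]
      linarith
  have hsurj : Metric.closedBall (0 : Fin k → ℝ) 1 ⊆ π '' cantorDust k lam := by
    intro y hy
    refine ⟨addressPoint lam (address (1 / 2) y), addressPoint_mem_cantorDust h0 h1 _, ?_⟩
    simp only [hπ]
    have h9 : address lam (addressPoint lam (address (1 / 2) y)) = address (1 / 2) y :=
      funext fun n => (address_addressPoint h0 h1 (address (1 / 2) y) n).1
    rw [h9]
    exact addressPoint_address (by norm_num) (by norm_num) (mem_cantorDust_half (by simpa using hy))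
  have hdim : dimH (Metric.closedBall (0 : Fin k → ℝ) 1) = k := by
    rw [Real.dimH_of_nonempty_interior, Module.finrank_fin_fun]
    exact ⟨0, Metric.ball_subset_interior_closedBall (Metric.mem_ball_self one_pos)⟩
  have h8 := (dimH_mono hsurj).trans (hhol.dimH_image_le hs)
  rw [hdim] at h8
  exact ENNReal.mul_le_of_le_div h8

/-- The upper bound: count the cubes of the `n`-th generation. -/
lemma dimH_cantorDust_le (h0 : 0 < lam) (h1 : lam < 1) {d : ℝ≥0}
    (hd : lam ^ (d : ℝ) = (1 / 2) ^ k) : dimH (cantorDust k lam) ≤ d := by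
  have hdiam : ∀ (n : ℕ) (c : Fin k → ℝ),
      Metric.ediam (Metric.closedBall c (lam ^ n)) ≤ ENNReal.ofReal (2 * lam ^ n) := by
    intro n c
    refine Metric.ediam_le fun x hx y hy => ?_
    rw [edist_dist]
    refine ENNReal.ofReal_le_ofReal ((dist_triangle_right x y c).trans ?_)
    rw [Metric.mem_closedBall] at hx hy
    linarith
  refine dimH_le_of_hausdorffMeasure_ne_top (ne_top_of_le_ne_top (b := ENNReal.ofReal (2 ^ (d : ℝ)))
    ENNReal.ofReal_ne_top ?_)
  have hcov := MeasureTheory.Measure.hausdorffMeasure_le_liminf_sum (d : ℝ) (cantorDust k lam)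
    (l := Filter.atTop) (ι := fun n : ℕ => Fin n → Fin k → Bool)
    (fun n : ℕ => ENNReal.ofReal (2 * lam ^ n)) ?_
    (fun n w => Metric.closedBall (∑ j : Fin n, lam ^ (j : ℕ) • cubeCorner (w j)) (lam ^ n))
    ?_ ?_
  · refine hcov.trans ?_
    refine (Filter.liminf_le_liminf (Filter.Eventually.of_forall fun n => ?_)).trans
      (Filter.liminf_const (ENNReal.ofReal (2 ^ (d : ℝ)))).le
    refine (Finset.sum_le_sum fun w _ =>
      ENNReal.rpow_le_rpow (hdiam n _) d.coe_nonneg).trans (le_of_eq ?_)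
    rw [Finset.sum_const, Finset.card_univ]
    simp only [Fintype.card_fun, Fintype.card_fin, Fintype.card_bool, nsmul_eq_mul]
    rw [ENNReal.ofReal_rpow_of_nonneg (by positivity) d.coe_nonneg, ← ENNReal.ofReal_natCast,
      ← ENNReal.ofReal_mul (by positivity), Real.mul_rpow (by norm_num) (by positivity)]
    have h2 : (lam ^ n) ^ (d : ℝ) = ((1 / 2) ^ k) ^ n := by
      rw [← hd, ← Real.rpow_natCast, ← Real.rpow_natCast, ← Real.rpow_mul h0.le,
        ← Real.rpow_mul h0.le, mul_comm]
    have h3 : (((2 ^ k) ^ n : ℕ) : ℝ) * ((1 / 2) ^ k) ^ n = 1 := by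
      push_cast
      rw [← mul_pow, ← mul_pow]; norm_num
    rw [h2, mul_left_comm, h3, mul_one]
  · have h2 := (tendsto_pow_atTop_nhds_zero_of_lt_one h0.le h1).const_mul 2
    rw [mul_zero] at h2
    simpa using ENNReal.tendsto_ofReal h2
  · exact Filter.Eventually.of_forall fun n w => hdiam n _
  · refine Filter.Eventually.of_forall fun n x hx => ?_
    refine Set.mem_iUnion.2 ⟨fun j => address lam x j, ?_⟩
    rw [Metric.mem_closedBall, dist_eq_norm,
      Fin.sum_univ_eq_sum_range fun j => lam ^ j • cubeCorner (address lam x j)]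
    have := hx n
    rwa [cubeCenter_eq_cornerSum] at this

end Address

/-- Every positive dimension less than `k` occurs: take `lam = 2 ^ (-k / d)`. -/
lemma exists_dimH_cantorDust_eq {k : ℕ} (hk : 0 < k) {d : ℝ≥0} (h0 : 0 < d) (hd : d < k) :
    ∃ lam : ℝ, 0 < lam ∧ lam < 1 / 2 ∧ dimH (cantorDust k lam) = d := by
  have hk' : (0 : ℝ) < k := by exact_mod_cast hk
  have hd0 : (0 : ℝ) < d := h0
  have hdk : (d : ℝ) < k := by exact_mod_cast hd
  have hpos : 0 < ((1 / 2 : ℝ)) ^ ((k : ℝ) / d) := by positivity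
  have hlt : ((1 / 2 : ℝ)) ^ ((k : ℝ) / d) < 1 / 2 := by
    have := Real.rpow_lt_rpow_of_exponent_gt (x := 1 / 2) (by norm_num) (by norm_num)
      ((one_lt_div hd0).2 hdk)
    rwa [Real.rpow_one] at this
  refine ⟨_, hpos, hlt, le_antisymm (dimH_cantorDust_le hpos (by linarith) ?_) ?_⟩
  · rw [← Real.rpow_mul (by norm_num), div_mul_cancel₀ _ hd0.ne', Real.rpow_natCast]
  · have h := le_dimH_cantorDust (k := k) hpos hlt (s := d / k) (by positivity) (by
      rw [← Real.rpow_mul (by norm_num)]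
      push_cast
      rw [div_mul_div_cancel₀ hd0.ne', div_self hk'.ne', Real.rpow_one])
    refine le_trans (le_of_eq ?_) h
    have : (k : ℝ≥0) * (d / k) = d := by field_simp
    rw [← this]; push_cast; simp [this]

/-! ### The dust as a compact subset of the open unit cube -/

section Dust

variable {k : ℕ} {lam : ℝ}

lemma isClosed_cantorDust (h0 : 0 < lam) (h1 : lam < 1 / 2) : IsClosed (cantorDust k lam) := by
  have hrange : cantorDust k lam = Set.range (addressPoint (k := k) lam) := by
    refine Set.Subset.antisymm (fun x hx => ⟨_, addressPoint_address h0 (by linarith) hx⟩) ?_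
    rintro _ ⟨ω, rfl⟩
    exact addressPoint_mem_cantorDust h0 h1 ω
  have hcont : Continuous (addressPoint (k := k) lam) := by
    refine continuous_tsum (fun j => ?_) (summable_geometric_of_lt_one h0.le (by linarith))
      fun j ω => ?_
    · have hc : Continuous fun ω : ℕ → Fin k → Bool => ω j := continuous_apply j
      have hc' : Continuous fun ω : ℕ → Fin k → Bool => cubeCorner (ω j) :=
        (continuous_of_discreteTopology (f := cubeCorner (k := k))).comp hc
      exact hc'.const_smul (lam ^ j)
    · have := norm_smul_cubeCorner_le (k := k) (pow_pos h0 j) (ω j)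
      have := pow_pos h0 j
      linarith
  rw [hrange]
  exact (isCompact_range hcont).isClosed

lemma norm_lt_one_of_mem_cantorDust (h1 : lam < 1 / 2) {x : Fin k → ℝ}
    (hx : x ∈ cantorDust k lam) : ‖x‖ < 1 := by
  have h := hx 1
  have h2 := norm_cubeCorner_le (signPattern x)
  have h3 : cubeCenter lam x 1 = cubeCorner (signPattern x) := by simp [cubeCenter]
  rw [h3, pow_one] at h
  linarith [norm_sub_norm_le x (cubeCorner (signPattern x))]

lemma zero_notMem_cantorDust (i : Fin k) (h1 : lam < 1 / 2) :
    (0 : Fin k → ℝ) ∉ cantorDust k lam := by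
  intro hx
  have h := (norm_le_pi_norm _ i).trans (hx 1)
  simp [cubeCenter, cubeCorner, signPattern] at h
  linarith

end Dust

/-! ### Tangent spaces of graphs -/

section Graph

variable {E : Type*} [NormedAddCommGroup E] [InnerProductSpace ℝ E] [FiniteDimensional ℝ E]
  (W : Submodule ℝ E)

lemma projOnto_add_projOnto (v : E) :
    (W.orthogonalProjectionOnto v : E) + (Wᗮ.orthogonalProjectionOnto v : E) = v := by
  exact W.starProjection_add_starProjection_orthogonal v

lemma projOnto_coe_add_coe (w : W) (z : Wᗮ) : W.orthogonalProjectionOnto ((w : E) + z) = w := by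
  simp

lemma projOnto_orthogonal_coe_add_coe (w : W) (z : Wᗮ) :
    Wᗮ.orthogonalProjectionOnto ((w : E) + z) = z := by
  simp

variable {W}

lemma tangentVectors_graphOver {Ω : Set W} (hΩ : IsOpen Ω) {f : W → Wᗮ} {w : W} (hw : w ∈ Ω)
    {f' : W →L[ℝ] Wᗮ} (hf : HasFDerivAt f f' w) :
    tangentVectors (graphOver W Ω f) ((w : E) + f w) =
      {v | Wᗮ.orthogonalProjectionOnto v = f' (W.orthogonalProjectionOnto v)} := by
  ext v
  simp only [tangentVectors, Set.mem_ofPred_eq]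
  constructor
  · rintro ⟨γ, h0, hγ, hd⟩
    have hP : HasDerivAt (fun t => W.orthogonalProjectionOnto (γ t))
      (W.orthogonalProjectionOnto v) 0 :=
        W.orthogonalProjectionOnto.hasFDerivAt.comp_hasDerivAt 0 hd
    have hQ : HasDerivAt (fun t => Wᗮ.orthogonalProjectionOnto (γ t))
      (Wᗮ.orthogonalProjectionOnto v) 0 :=
        Wᗮ.orthogonalProjectionOnto.hasFDerivAt.comp_hasDerivAt 0 hd
    have hw0 : W.orthogonalProjectionOnto (γ 0) = w := by rw [h0, projOnto_coe_add_coe]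
    have hf0 : HasFDerivAt f f' (W.orthogonalProjectionOnto (γ 0)) := by rwa [hw0]
    have hfP := hf0.comp_hasDerivAt (0 : ℝ) hP
    refine (hQ.congr_of_eventuallyEq ?_).unique hfP
    filter_upwards [hγ] with t ht
    obtain ⟨y, -, hy⟩ := ht
    simp only [Function.comp]
    rw [hy, projOnto_coe_add_coe, projOnto_orthogonal_coe_add_coe]
  · intro hv
    set p := W.orthogonalProjectionOnto v with hp
    have hline : HasDerivAt (fun t : ℝ => w + t • p) p 0 := by
      simpa using ((hasDerivAt_id (0 : ℝ)).smul_const p).const_add w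
    have hf0 : HasFDerivAt f f' (w + (0 : ℝ) • p) := by simpa using hf
    have h1 := W.subtypeL.hasFDerivAt.comp_hasDerivAt (0 : ℝ) hline
    have h2 := Wᗮ.subtypeL.hasFDerivAt.comp_hasDerivAt (0 : ℝ) (hf0.comp_hasDerivAt (0 : ℝ) hline)
    refine ⟨fun t => ((w + t • p : W) : E) + f (w + t • p), by simp, ?_, ?_⟩
    · have hcont : ContinuousAt (fun t : ℝ => w + t • p) 0 := hline.continuousAt
      have := hcont.eventually_mem (hΩ.mem_nhds (by simpa using hw))
      filter_upwards [this] with t ht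
      exact ⟨_, ht, rfl⟩
    · have h3 := h1.add h2
      have h4 : v = W.subtypeL p + Wᗮ.subtypeL (f' p) := by
        rw [← hv]; exact (projOnto_add_projOnto W v).symm
      rw [h4]
      exact h3

/-- Near the origin, a distribution of class `C^1` consists of the graphs of the linear maps `A x`
from `W = V 0` to its orthogonal complement, where `A` is of class `C^1`. -/
lemma exists_chart {k : ℕ} {V : E → Submodule ℝ E} (hV : IsC1Distribution k V) :
    ∃ (W : Submodule ℝ E) (A : E → (W →L[ℝ] Wᗮ)), Module.finrank ℝ W = k ∧ ContDiffAt ℝ 1 A 0 ∧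
      A 0 = 0 ∧ ∀ᶠ x in 𝓝 (0 : E), ∀ v, v ∈ V x ↔
        Wᗮ.orthogonalProjectionOnto v = A x (W.orthogonalProjectionOnto v) := by
  obtain ⟨hrank, hloc⟩ := hV
  obtain ⟨U, hU, h0U, X, hX, hspan⟩ := hloc 0
  have hUn : U ∈ 𝓝 (0 : E) := hU.mem_nhds h0U
  set W := V 0 with hW
  set P := W.orthogonalProjectionOnto with hP
  set Q := Wᗮ.orthogonalProjectionOnto with hQ
  set Y : E → ((Fin k → ℝ) →L[ℝ] E) := fun x =>
    ∑ i, (ContinuousLinearMap.proj i : (Fin k → ℝ) →L[ℝ] ℝ).smulRight (X i x) with hY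
  have hYs : ContDiffAt ℝ 1 Y 0 := by
    refine ContDiffAt.sum fun i _ => ?_
    have h := (hX i).contDiffAt hUn
    exact ((ContinuousLinearMap.smulRightL ℝ (Fin k → ℝ) E
      (ContinuousLinearMap.proj i)).contDiff.contDiffAt (x := X i 0)).comp (0 : E) h
  have hYa : ∀ x c, Y x c = ∑ i, c i • X i x := fun x c => by
    simp [hY]
  have hmem : ∀ x ∈ U, ∀ v, v ∈ V x ↔ ∃ c, Y x c = v := by
    intro x hx v
    rw [hspan x hx, Submodule.mem_span_range_iff_exists_fun]
    simp only [hYa]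
  set T : E → ((Fin k → ℝ) →L[ℝ] W) := fun x => P.comp (Y x) with hT
  have hTs : ContDiffAt ℝ 1 T 0 := contDiffAt_const.clm_comp hYs
  have hsurj : Function.Surjective (T 0) := by
    intro w
    obtain ⟨c, hc⟩ := (hmem 0 h0U w).1 w.2
    refine ⟨c, ?_⟩
    have h1 : T 0 c = P (Y 0 c) := rfl
    rw [h1, hc]
    exact W.orthogonalProjectionOnto_mem_subspace_eq_self w
  have hinj : Function.Injective (T 0) := by
    refine (LinearMap.injective_iff_surjective_of_finrank_eq_finrank (f := (T 0).toLinearMap) ?_).2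
      hsurj
    rw [Module.finrank_fin_fun, hrank 0]
  have hinv0 : (T 0).IsInvertible :=
    ⟨(LinearEquiv.ofBijective (T 0).toLinearMap ⟨hinj, hsurj⟩).toContinuousLinearEquiv, rfl⟩
  have hinv : ∀ᶠ x in 𝓝 (0 : E), (T x).IsInvertible := by
    obtain ⟨e, he⟩ := hinv0
    have := ContinuousLinearEquiv.nhds e
    rw [he] at this
    exact hTs.continuousAt.eventually this
  set A : E → (W →L[ℝ] Wᗮ) := fun x => (Q.comp (Y x)).comp (T x).inverse with hA
  have hmain : ∀ᶠ x in 𝓝 (0 : E), ∀ v, v ∈ V x ↔ Q v = A x (P v) := by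
    filter_upwards [hUn, hinv] with x hx hTx v
    rw [hmem x hx]
    obtain ⟨e, he⟩ := hTx
    have hTe : ∀ c, P (Y x c) = e c := fun c => by
      have : T x c = e c := by rw [← he]; rfl
      exact this
    have hAv : A x (P v) = Q (Y x (e.symm (P v))) := by
      simp only [hA, ← he, ContinuousLinearMap.inverse_equiv]; rfl
    rw [hAv]
    constructor
    · rintro ⟨c, rfl⟩
      rw [hTe, e.symm_apply_apply]
    · intro h
      refine ⟨e.symm (P v), ?_⟩
      have h1 : W.orthogonalProjectionOnto (Y x (e.symm (P v))) = P v := by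
        have := hTe (e.symm (P v))
        rwa [e.apply_symm_apply] at this
      have h2 : Wᗮ.orthogonalProjectionOnto (Y x (e.symm (P v))) = Q v := h.symm
      refine (projOnto_add_projOnto W _).symm.trans ?_
      rw [h1, h2]
      exact projOnto_add_projOnto W v
  refine ⟨W, A, hrank 0, ?_, ?_, hmain⟩
  · exact (contDiffAt_const.clm_comp hYs).clm_comp (hinv0.contDiffAt_map_inverse.comp 0 hTs)
  · ext1 w
    have h1 := (hmain.self_of_nhds (w : E)).1 w.2
    have h2 := projOnto_coe_add_coe W w 0
    have h3 := projOnto_orthogonal_coe_add_coe W w 0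
    simp only [ZeroMemClass.coe_zero, add_zero] at h2 h3
    rw [hP, hQ, h2, h3] at h1
    rw [← h1]; rfl

end Graph

/-! ### The submanifold -/

section Construction

variable {E : Type*} [NormedAddCommGroup E] [InnerProductSpace ℝ E] [FiniteDimensional ℝ E]

lemma linearMap_graph_eq_iff {W : Submodule ℝ E} (f A : W →L[ℝ] Wᗮ) :
    {v : E | Wᗮ.orthogonalProjectionOnto v = f (W.orthogonalProjectionOnto v)} =
      {v : E | Wᗮ.orthogonalProjectionOnto v = A (W.orthogonalProjectionOnto v)} ↔ f = A := by
  refine ⟨fun h => ?_, fun h => by rw [h]⟩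
  ext1 w
  have h1 : ((w : E) + f w) ∈ {v : E | Wᗮ.orthogonalProjectionOnto v =
      A (W.orthogonalProjectionOnto v)} := by
    rw [← h, Set.mem_ofPred_eq, projOnto_coe_add_coe, projOnto_orthogonal_coe_add_coe]
  rwa [Set.mem_ofPred_eq, projOnto_coe_add_coe, projOnto_orthogonal_coe_add_coe] at h1

/-- Parametrizing `V 0` by `ℝ^k` on the small scale `t` makes the chart of `V` a field of
differentials with an arbitrarily small Lipschitz constant. -/
lemma exists_scale {E : Type*} [NormedAddCommGroup E] [InnerProductSpace ℝ E]
    {W : Submodule ℝ E} {F : Type*} [NormedAddCommGroup F] [NormedSpace ℝ F]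
    (ι : W ≃L[ℝ] F) {A : E → (W →L[ℝ] Wᗮ)} (hA : ContDiffAt ℝ 1 A 0) {s : Set E}
    (hs : s ∈ 𝓝 (0 : E)) {ε : ℝ≥0} (hε : 0 < ε) :
    ∃ t : ℝ, 0 < t ∧
      (∀ p : F × Wᗮ, ‖p‖ ≤ 3 → t • (((ι.symm p.1 : W) : E) + p.2) ∈ s) ∧
      LipschitzOnWith ε (fun p : F × Wᗮ =>
        (A (t • (((ι.symm p.1 : W) : E) + p.2))).comp (ι.symm : F →L[ℝ] W))
        (Metric.closedBall 0 3) := by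
  obtain ⟨L, u, hu, hL⟩ := hA.exists_lipschitzOnWith
  obtain ⟨R, hR, hball⟩ := Metric.mem_nhds_iff.1 (Filter.inter_mem hs hu)
  set N : ℝ := ‖(ι.symm : F →L[ℝ] W)‖ with hN
  have hN0 : 0 ≤ N := by positivity
  have hε' : (0 : ℝ) < ε := hε
  -- The first bound on `t` keeps the points inside `s ∩ u`, the second one gives
  -- the Lipschitz constant.
  set t : ℝ := min (R / (4 * (N + 1))) (ε / (L * (N + 1) * (N + 1) + 1)) with ht
  have ht0 : 0 < t := lt_min (by positivity) (by positivity)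
  have ht1 : t * (4 * (N + 1)) ≤ R := (le_div_iff₀ (by positivity)).1 (min_le_left _ _)
  have ht2 : t * (L * (N + 1) * (N + 1) + 1) ≤ ε :=
    (le_div_iff₀ (by positivity)).1 (min_le_right _ _)
  have hlin : ∀ p : F × Wᗮ, ‖((ι.symm p.1 : W) : E) + p.2‖ ≤ (N + 1) * ‖p‖ := by
    intro p
    have h1 : ‖((ι.symm p.1 : W) : E)‖ ≤ N * ‖p‖ :=
      ((ι.symm : F →L[ℝ] W).le_opNorm p.1).trans (by gcongr; exact le_max_left _ _)
    have h2 : ‖(p.2 : E)‖ ≤ ‖p‖ := le_max_right ‖p.1‖ ‖p.2‖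
    exact (norm_add_le _ _).trans (by linarith)
  have hin : ∀ p : F × Wᗮ, ‖p‖ ≤ 3 → t • (((ι.symm p.1 : W) : E) + p.2) ∈ s ∩ u := by
    intro p hp
    apply hball
    rw [mem_ball_zero_iff, norm_smul, Real.norm_eq_abs, abs_of_pos ht0]
    calc t * _ ≤ t * ((N + 1) * 3) := by gcongr; exact (hlin p).trans (by gcongr)
      _ < t * (4 * (N + 1)) := mul_lt_mul_of_pos_left (by linarith) ht0
      _ ≤ R := ht1
  refine ⟨t, ht0, fun p hp => (hin p hp).1, LipschitzOnWith.of_dist_le_mul fun p hp q hq => ?_⟩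
  rw [mem_closedBall_zero_iff] at hp hq
  have h1 := hL.dist_le_mul _ (hin p hp).2 _ (hin q hq).2
  rw [dist_eq_norm, dist_eq_norm, ← smul_sub, norm_smul, Real.norm_eq_abs, abs_of_pos ht0] at h1
  have h2 : (((ι.symm p.1 : W) : E) + p.2) - (((ι.symm q.1 : W) : E) + q.2) =
      ((ι.symm (p - q).1 : W) : E) + (p - q).2 := by
    simp only [Prod.fst_sub, Prod.snd_sub, map_sub, Submodule.coe_sub]; abel
  rw [h2] at h1
  have h3 := hlin (p - q)
  rw [dist_eq_norm, dist_eq_norm, ← ContinuousLinearMap.sub_comp]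
  refine (ContinuousLinearMap.opNorm_comp_le _ _).trans ?_
  calc _ ≤ (L * (t * ((N + 1) * ‖p - q‖))) * (N + 1) := by
        gcongr
        · exact h1.trans (by gcongr)
        · linarith
    _ = (t * (L * (N + 1) * (N + 1))) * ‖p - q‖ := by ring
    _ ≤ ε * ‖p - q‖ := by gcongr; linarith

/-- Over every open subset `O` of the unit cube there is a graph of class `C^{1,1}` that is tangent
to `V` exactly over the part of the dust in `O`. -/
lemma exists_submanifold {k : ℕ} (hk : 0 < k) (hkE : k < Module.finrank ℝ E)
    {V : E → Submodule ℝ E} (hV : IsC1Distribution k V) {lam : ℝ} (h0 : 0 < lam) (h1 : lam < 1 / 2)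
    {O : Set (Fin k → ℝ)} (hO : IsOpen O) (hne : O.Nonempty) (hO1 : ∀ y ∈ O, ‖y‖ ≤ 1) :
    ∃ S : Set E, S.Nonempty ∧ IsC11Submanifold k S ∧
      dimH (tangencySet S V) = dimH (O ∩ cantorDust k lam) := by
  obtain ⟨W, A, hfin, hA, hA0, hchart⟩ := exists_chart hV
  have hsum := W.finrank_add_finrank_orthogonal
  have : Nontrivial Wᗮ := Module.nontrivial_of_finrank_pos (R := ℝ) (by omega)
  set ι : W ≃L[ℝ] (Fin k → ℝ) := ContinuousLinearEquiv.ofFinrankEq (by simp [hfin]) with hι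
  obtain ⟨ε, hε, hcore⟩ := exists_fderiv_eq_iff_mem_cantorDust ⟨0, hk⟩ Wᗮ h0 h1
  obtain ⟨t, ht, hs, hlip⟩ := exists_scale ι hA hchart hε
  obtain ⟨g, hg, ⟨L, hL⟩, hgK⟩ := hcore _ hlip (by simp [hA0])
  set m : W →L[ℝ] (Fin k → ℝ) := t⁻¹ • (ι : W →L[ℝ] (Fin k → ℝ)) with hm
  have hmι : ∀ y, m (t • ι.symm y) = y := fun y => by
    simp [hm, smul_smul, ht.ne']
  have hιm : ∀ w, t • ι.symm (m w) = w := fun w => by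
    simp [hm, smul_smul, ht.ne']
  set f : W → Wᗮ := fun w => t • g (m w) with hf
  have hfd : ∀ w, HasFDerivAt f ((fderiv ℝ g (m w)).comp (ι : W →L[ℝ] (Fin k → ℝ))) w := by
    intro w
    have h2 := ((hg.differentiable (by simp) (m w)).hasFDerivAt.comp w m.hasFDerivAt).const_smul t
    refine h2.congr_fderiv ?_
    ext1 v
    simp [hm, smul_smul, ht.ne']
  have hfs : ContDiff ℝ 1 f := (hg.comp m.contDiff).const_smul t
  have hfd' : fderiv ℝ f = fun w => (fderiv ℝ g (m w)).comp (ι : W →L[ℝ] (Fin k → ℝ)) :=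
    funext fun w => (hfd w).fderiv
  set Ω : Set W := m ⁻¹' O with hΩ
  have hΩo : IsOpen Ω := hO.preimage m.continuous
  -- The graph is parametrized over `O` by `Γ`, with inverse `t⁻¹ • ι ∘ P`.
  set Γ : (Fin k → ℝ) → E := fun y => t • (((ι.symm y : W) : E) + g y) with hΓ
  have hΓf : ∀ w : W, (w : E) + f w = Γ (m w) := by
    intro w
    have h2 : ((t • ι.symm (m w) : W) : E) = w := by rw [hιm]
    have h3 : Γ (m w) = ((t • ι.symm (m w) : W) : E) + f w := smul_add _ _ _
    rw [h3, h2]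
  have hΓinv : ∀ y, m (W.orthogonalProjectionOnto (Γ y)) = y := by
    intro y
    rw [hΓ]
    simp only [map_smul, projOnto_coe_add_coe]
    rw [← map_smul, hmι]
  have htan : ∀ w ∈ Ω, tangentVectors (graphOver W Ω f) ((w : E) + f w) = V ((w : E) + f w) ↔
      m w ∈ cantorDust k lam := by
    intro w hw
    have hw1 : ‖m w‖ ≤ 1 := hO1 _ hw
    obtain ⟨hg3, hiff⟩ := hgK (m w) hw1
    have hmem := hs (m w, g (m w)) (max_le (hw1.trans (by norm_num)) hg3)
    have hVset : (V ((w : E) + f w) : Set E) = {v : E | Wᗮ.orthogonalProjectionOnto v =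
        A ((w : E) + f w) (W.orthogonalProjectionOnto v)} := by
      ext v
      rw [hΓf]
      exact hmem v
    rw [tangentVectors_graphOver hΩo hw (hfd w), hVset, linearMap_graph_eq_iff, ← hiff, hΓf]
    constructor
    · intro h
      change _ = (A (Γ (m w))).comp (ι.symm : (Fin k → ℝ) →L[ℝ] W)
      rw [← h]
      ext1 v; simp
    · intro h
      change _ = (A (Γ (m w))).comp (ι.symm : (Fin k → ℝ) →L[ℝ] W) at h
      rw [h]
      ext1 v; simp
  refine ⟨graphOver W Ω f, ?_, ?_, ?_⟩
  · obtain ⟨y, hy⟩ := hne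
    exact ⟨_, t • ι.symm y, by rw [hΩ, Set.mem_preimage, hmι]; exact hy, rfl⟩
  · intro p _
    refine ⟨Set.univ, isOpen_univ, Set.mem_univ p, W, hfin, Ω, f, hΩo, ⟨hfs.contDiffOn, ?_⟩,
      Set.inter_univ _⟩
    rw [hfd']
    have h2 := ((ContinuousLinearMap.compL ℝ W (Fin k → ℝ) Wᗮ).flip
      (ι : W →L[ℝ] (Fin k → ℝ))).lipschitz.comp (hL.comp m.lipschitz)
    exact ⟨_, h2.lipschitzOnWith⟩
  · have himage : tangencySet (graphOver W Ω f) V = Γ '' (O ∩ cantorDust k lam) := by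
      ext p
      constructor
      · rintro ⟨⟨w, hw, rfl⟩, hT⟩
        exact ⟨m w, ⟨hw, (htan w hw).1 hT⟩, (hΓf w).symm⟩
      · rintro ⟨y, ⟨hyO, hyK⟩, rfl⟩
        have hw : t • ι.symm y ∈ Ω := by rw [hΩ, Set.mem_preimage, hmι]; exact hyO
        have hp := hΓf (t • ι.symm y)
        have hT := htan _ hw
        rw [hmι] at hT hp
        rw [← hp]
        exact ⟨⟨_, hw, rfl⟩, hT.2 hyK⟩
    rw [himage]
    refine le_antisymm ?_ ?_
    · have hΓs : ContDiff ℝ 1 Γ := by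
        have h2 : ContDiff ℝ 1 fun y => ((ι.symm y : W) : E) :=
          (W.subtypeL.comp (ι.symm : (Fin k → ℝ) →L[ℝ] W)).contDiff
        have h3 : ContDiff ℝ 1 fun y => ((g y : Wᗮ) : E) := Wᗮ.subtypeL.contDiff.comp hg
        exact (h2.add h3).const_smul t
      exact hΓs.contDiffOn.dimH_image_le convex_univ (Set.subset_univ _)
    · have h2 : (m.comp W.orthogonalProjectionOnto) '' (Γ '' (O ∩ cantorDust k lam)) =
          O ∩ cantorDust k lam := by
        rw [Set.image_image]
        exact (Set.image_congr fun y _ => hΓinv y).trans (Set.image_id _)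
      have h3 := (m.comp W.orthogonalProjectionOnto).lipschitz.dimH_image_le
        (Γ '' (O ∩ cantorDust k lam))
      rwa [h2] at h3

end Construction

theorem mainTheorem5 (n k : ℕ) (hk : 2 ≤ k) (hkn : k < n)
    (V : EuclideanSpace ℝ (Fin n) → Submodule ℝ (EuclideanSpace ℝ (Fin n)))
    (hV : IsC1Distribution k V) (d : ℝ≥0) (hd : d < (k : ℝ≥0)) :
    ∃ S : Set (EuclideanSpace ℝ (Fin n)),
      S.Nonempty ∧ IsC11Submanifold k S ∧ dimH (tangencySet S V) = (d : ℝ≥0∞) := by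
  have hk0 : 0 < k := by omega
  have hkE : k < Module.finrank ℝ (EuclideanSpace ℝ (Fin n)) := by simpa using hkn
  rcases eq_or_ne d 0 with rfl | hd0
  · -- For `d = 0` remove the dust from the domain; the origin is not in the dust.
    obtain ⟨S, hne, hS, hdim⟩ := exists_submanifold hk0 hkE hV (lam := 1 / 4) (by norm_num)
      (by norm_num) (O := Metric.ball 0 1 ∩ (cantorDust k (1 / 4))ᶜ)
      (Metric.isOpen_ball.inter (isClosed_cantorDust (by norm_num) (by norm_num)).isOpen_compl)
      ⟨0, Metric.mem_ball_self one_pos, zero_notMem_cantorDust ⟨0, hk0⟩ (by norm_num)⟩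
      (fun y hy => (mem_ball_zero_iff.1 hy.1).le)
    refine ⟨S, hne, hS, hdim.trans ?_⟩
    rw [Set.inter_assoc, Set.compl_inter_self, Set.inter_empty, dimH_empty, ENNReal.coe_zero]
  · obtain ⟨lam, h0, h1, hlam⟩ := exists_dimH_cantorDust_eq hk0 (pos_iff_ne_zero.2 hd0) hd
    obtain ⟨S, hne, hS, hdim⟩ := exists_submanifold hk0 hkE hV h0 h1 (O := Metric.ball 0 1)
      Metric.isOpen_ball ⟨0, Metric.mem_ball_self one_pos⟩ (fun y hy => (mem_ball_zero_iff.1 hy).le)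
    refine ⟨S, hne, hS, hdim.trans ?_⟩
    rw [Set.inter_eq_right.2 fun y hy =>
      mem_ball_zero_iff.2 (norm_lt_one_of_mem_cantorDust h1 hy), hlam]
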